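/- Let $L_\infty>0$, $\mu>0$, $\mathbb{R}^3_+=\{(x,y,z)\in\mathbb{R}^3: z>0\}$, and let $\boldsymbol{\xi}=(\xi_1,\xi_2,\xi_3)$ be three-component Gaussian white noise on $\mathbb{R}^3_+$, i.e. the variables $\xi_i(f)$, $f\in L^2(\mathbb{R}^3_+)$, $i=1,2,3$, are jointly Gaussian and centred with $\langle \xi_i(f)\xi_j(g)\rangle=\delta_{ij}\int_{\mathbb{R}^3_+} fg\,d\boldsymbol{x}$. Let $A=1-L_\infty^2\Delta$ be the self-adjoint operator on $L^2(\mathbb{R}^3_+)$ with domain $\{\varphi\in H^2(\mathbb{R}^3_+):\varphi=0 \text{ on } z=0 \text{ in the sense of traces}\}$, and define its fractional powers through the spectral theorem ($A^\alpha=U^*\lambda^\alpha U$ whenever the unitary $U$ carries $A$ to multiplication by $\lambda$). Let the random vector potential $\boldsymbol{\psi}=(\psi_1,\psi_2,\psi_3)$ be any solution of the half-space von Kármán problem with diffusion tensor $L_\infty^2 I$ and full Dirichlet boundary condition, $$(1-L_\infty^2\Delta)^{17/12}\boldsymbol{\psi}=\mu L_\infty^{17/6}\boldsymbol{\xi}\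 \text{ in }\mathbb{R}^3_+,\qquad \boldsymbol{\psi}=0\ \text{ at } z=0,$$ in the sense of distributions: each $\psi_i$ is a random distribution on $\mathbb{R}^3_+$ with square-integrable values, and $\psi_i(A^{17/12}\varphi)=\mu L_\infty^{17/6}\,\xi_i(\varphi)$ almost surely for every real $\varphi$ in the domain of $A^{17/12}$ for which $A^{17/12}\varphi$ is a test function in $C_c^\infty(\mathbb{R}^3_+)$. Then the distributional curl $\mathbf{u}=(u,v,w)=\nabla\times\boldsymbol{\psi}$ is represented by a random field with finite second moments that is continuous in mean square on $\mathbb{R}^3_+$. For every such representative, $\langle u^2\rangle$ and $\langle v^2\rangle$ have a common limit $\langle u_\infty^2\rangle=\langle v_\infty^2\rangle>0$ as $z\to\infty$ and, at every point of $\mathbb{R}^3_+$, $$\frac{\langle u^2\rangle}{\langle u_\infty^2\rangle}=\frac{\langle v^2\rangle}{\langle v_\infty^2\rangle}=1+\nu\,\mathcal{M}_\nu\!\left(\frac{2z}{L_\infty}\right)-\nu\,\mathcal{M}_{\nu+1}\!\left(\frac{2z}{L_\infty}\right),\qquad \nu=\tfrac13,$$ where $\mathcal{M}_\nu(x)=\dfrac{x^\nu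 K_\nu(x)}{2^{\nu-1}\Gamma(\nu)}$ is the Matérn kernel and $K_\nu$ is the modified Bessel function of the second kind. Hence $\dfrac{\langle u^2\rangle}{\langle u_\infty^2\rangle}=\dfrac{\langle v^2\rangle}{\langle v_\infty^2\rangle}\to 1$ as $\dfrac{z}{L_\infty}\to 0$. -/

import Mathlib

open MeasureTheory ProbabilityTheory Filter Topology
open scoped Distributions LineDeriv ENNReal

noncomputable section

/-- Physical space `ℝ³`; the coordinates are `x 0 = x`, `x 1 = y`, `x 2 = z`. -/
abbrev E3 : Type := EuclideanSpace ℝ (Fin 3)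

/-- The unit vector in the direction of the `i`-th coordinate. -/
def e3 (i : Fin 3) : E3 := EuclideanSpace.single i 1

/-- The open half-space `z > 0`. -/
def halfSpace : TopologicalSpace.Opens E3 :=
  ⟨{x : E3 | 0 < x 2}, isOpen_lt continuous_const (by fun_prop)⟩

/-- Lebesgue measure on the half-space. -/
def volH : Measure E3 := volume.restrict (halfSpace : Set E3)

/-- Real square-integrable functions on the half-space. -/
abbrev L2R : Type := Lp ℝ 2 volH

/-- Complex square-integrable functions on the half-space. -/
abbrev L2C : Type := Lp ℂ 2 volH

/-! ### The operator `1 - L²Δ` on the half-space with the Dirichlet condition -/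

/-- `g` is the weak partial derivative `∂ᵢ φ` on the half-space. -/
def IsWeakPartial (i : Fin 3) (φ g : L2C) : Prop :=
  ∀ η : 𝓓(halfSpace, ℝ),
    ∫ x, φ x * ((∂_{e3 i} η) x : ℂ) ∂volH = - ∫ x, g x * (η x : ℂ) ∂volH

/-- The trace on `z = 0` of a function `φ` with normal derivative `g = ∂_z φ` vanishes: Green's
formula has no boundary term, for all test functions on `ℝ³`, which need not vanish at `z = 0`
(in general the boundary term is `- ∫ φ(x, y, 0) η(x, y, 0) dx dy` on the right-hand side). -/
def HasZeroTrace (φ g : L2C) : Prop :=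
  ∀ η : 𝓓((⊤ : TopologicalSpace.Opens E3), ℝ),
    ∫ x, φ x * ((∂_{e3 2} η) x : ℂ) ∂volH = - ∫ x, g x * (η x : ℂ) ∂volH

/-- The graph of `A = 1 - ∇·(L²∇)` on the half-space, with domain
`{φ ∈ H² : φ = 0 on z = 0 in the sense of traces}`: `DirichletOp L φ f` says that `φ` is in the
domain and `A φ = f`. With a full Dirichlet condition and a scalar constant diffusion tensor the
operator on vector fields acts as this one on each of the three components. -/
def DirichletOp (L : ℝ) (φ f : L2C) : Prop :=
  ∃ (g : Fin 3 → L2C) (h : Fin 3 → Fin 3 → L2C),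
    (∀ i, IsWeakPartial i φ (g i)) ∧
    (∀ i j, IsWeakPartial j (g i) (h i j)) ∧
    HasZeroTrace φ (g 2) ∧
    f = φ - ((L ^ 2 : ℝ) : ℂ) • ∑ i, h i i

/-! ### Fractional powers through the spectral theorem -/

/-- The unitary map `U : H → L²(Y, m)` carries the operator with graph `A` to the operator of
multiplication by the real function `lam`, with its maximal domain. -/
def Diagonalizes {H : Type*} [NormedAddCommGroup H] [InnerProductSpace ℂ H]
    (A : H → H → Prop) {Y : Type} [MeasurableSpace Y] (m : Measure Y) (lam : Y → ℝ)
    (U : H ≃ₗᵢ[ℂ] Lp ℂ 2 m) : Prop :=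
  ∀ φ f : H, A φ f ↔ ∀ᵐ y ∂m, U f y = (lam y : ℂ) * U φ y

/-- The graph of the fractional power `A ^ α = U⁻¹ lam ^ α U` of a nonnegative self-adjoint operator
with graph `A`: `FracPow A α φ f` says that `φ` is in the domain of `A ^ α` and `A ^ α φ = f`.
By the uniqueness of the functional calculus it does not matter which diagonalization is used. -/
def FracPow {H : Type*} [NormedAddCommGroup H] [InnerProductSpace ℂ H]
    (A : H → H → Prop) (α : ℝ) (φ f : H) : Prop :=
  ∃ (Y : Type) (_ : MeasurableSpace Y) (m : Measure Y) (lam : Y → ℝ) (U : H ≃ₗᵢ[ℂ] Lp ℂ 2 m),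
    SigmaFinite m ∧ Measurable lam ∧ Diagonalizes A m lam U ∧
    ∀ᵐ y ∂m, U f y = ((lam y ^ α : ℝ) : ℂ) * U φ y

/-! ### Random fields -/

section RandomFields

variable {Ω : Type*} [MeasurableSpace Ω]

/-- Three-component Gaussian white noise on the half-space: `ξ i f` is the pairing of the `i`-th
component with `f`, and these variables are jointly Gaussian and centred with covariance
`E[ξ i f * ξ j g] = δ i j * ∫ f g`. -/
structure IsWhiteNoise (P : Measure Ω) (ξ : Fin 3 → L2R → Lp ℝ 2 P) : Prop where
  gaussian : IsGaussianProcess (fun (p : Fin 3 × L2R) (ω : Ω) => ξ p.1 p.2 ω) P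
  centred : ∀ i f, ∫ ω, ξ i f ω ∂P = 0
  covariance : ∀ i j f g,
    ∫ ω, ξ i f ω * ξ j g ω ∂P = if i = j then ∫ x, f x * g x ∂volH else 0

/-- A (square-integrable) random distribution on the half-space: it assigns to a test function `η`
the random variable `"∫ T(x) η(x) dx"`, up to almost sure equality. -/
abbrev RandomDistribution (P : Measure Ω) : Type _ := 𝓓(halfSpace, ℝ) →ₗ[ℝ] Lp ℝ 2 P

/-- `ψ` solves `(1 - L²Δ)^(17/12) ψ = μ L^(17/6) ξ` on the half-space with `ψ = 0` on `z = 0`, in the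
sense of distributions. The operator `A^(17/12)` is self-adjoint, so the equation says that the
pairing of `ψ` with `A^(17/12) φ` is that of `μ L^(17/6) ξ` with `φ`, for all real `φ` in the domain
of `A^(17/12)` for which `A^(17/12) φ` is a test function. The boundary condition enters through the
domain of `A`. -/
def IsVonKarmanSolution (P : Measure Ω) (L μ : ℝ) (ξ : Fin 3 → L2R → Lp ℝ 2 P)
    (ψ : Fin 3 → RandomDistribution P) : Prop :=
  ∀ (i : Fin 3) (φ : L2R) (η : 𝓓(halfSpace, ℝ)) (Φ H : L2C),
    (∀ᵐ x ∂volH, Φ x = (φ x : ℂ)) → (∀ᵐ x ∂volH, H x = (η x : ℂ)) →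
    FracPow (DirichletOp L) (17 / 12) Φ H →
    ψ i η = (μ * L ^ (17 / 6 : ℝ)) • ξ i φ

/-- The pairing of the distributional derivative `∂ⱼ T` with a test function. -/
def distPartial {P : Measure Ω} (j : Fin 3) (T : RandomDistribution P) (η : 𝓓(halfSpace, ℝ)) :
    Lp ℝ 2 P :=
  - T (∂_{e3 j} η)

/-- The pairing of the `i`-th component of the distributional curl with a test function. -/
def distCurl {P : Measure Ω} (ψ : Fin 3 → RandomDistribution P) (i : Fin 3)
    (η : 𝓓(halfSpace, ℝ)) : Lp ℝ 2 P :=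
  ![distPartial 1 (ψ 2) η - distPartial 2 (ψ 1) η,
    distPartial 2 (ψ 0) η - distPartial 0 (ψ 2) η,
    distPartial 0 (ψ 1) η - distPartial 1 (ψ 0) η] i

/-- `u = curl ψ` on the half-space, where `u` is a pointwise defined random field, continuous in
mean square (its value at `x` is the vector of the random variables `u i x`); its values outside the
half-space are irrelevant. -/
structure IsVelocity {P : Measure Ω} (ψ : Fin 3 → RandomDistribution P)
    (u : Fin 3 → E3 → Lp ℝ 2 P) : Prop where
  continuousOn : ∀ i, ContinuousOn (u i) (halfSpace : Set E3)
  eq_curl : ∀ (i : Fin 3) (η : 𝓓(halfSpace, ℝ)), ∫ x, η x • u i x ∂volH = distCurl ψ i η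

/-- The Reynolds stress `⟨uᵢ uⱼ⟩` at the point `x`. -/
def reynoldsStress {P : Measure Ω} (u : Fin 3 → E3 → Lp ℝ 2 P) (i j : Fin 3) (x : E3) : ℝ :=
  ∫ ω, u i x ω * u j x ω ∂P

end RandomFields

/-! ### The Matérn kernel -/

/-- The modified Bessel function of the second kind `K_ν(x)`, for `x > 0`. -/
def besselK (ν x : ℝ) : ℝ :=
  ∫ t in Set.Ioi (0 : ℝ), Real.exp (-(x * Real.cosh t)) * Real.cosh (ν * t)

/-- The Matérn kernel `x^ν K_ν(x) / (2^(ν-1) Γ(ν))`, for `x > 0`. -/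
def matern (ν x : ℝ) : ℝ :=
  x ^ ν * besselK ν x / (2 ^ (ν - 1) * Real.Gamma ν)

end

/-! Odd reflection in the plane z = 0 turns the Dirichlet operator into the whole-space operator 1 -
L²Δ restricted to odd functions. Hence the sine transform (Fourier transform of the odd extension)
is a unitary that carries A to multiplication by σ(k) = 1 + L²|2πk|², and A^(17/12) becomes
multiplication by σ^(17/12).

Since |k|²σ^(-17/6) is integrable on ℝ³ (it decays like |k|^(-11/3)), the x-gradient of the kernel
of A^(-17/12) is square integrable in y and depends continuously on x as an element of L². Let
g_j(x) be its j-th component. Pairing g_j with a test function η gives -A^(-17/12)∂_jη, so the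
equation for ψ says that ∂_jψ_i is represented by the field μ L^(17/6) ξ_i(g_j(x)). This gives
existence of the velocity; any two mean-square continuous representatives of the same distribution
coincide on the half-space, so it suffices to compute with this one (`IsVelocity.eqOn`).

Each of u and v is a difference of derivatives of two different components of ψ. These are
orthogonal, so the variance is the sum of a horizontal and the vertical ‖g_j(x)‖². By the method of
images (`norm_gradKernelR_sq`), ‖g_j(x)‖² is proportional to the integral of k_j² σ^(-17/6) (1 ∓
cos(4πz k_z)), with minus for horizontal j and plus for vertical j.

Writing Γ(p)σ^(-p) as the integral of t^(p-1)e^(-σt) reduces these to Gaussian moments and leaves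
one-dimensional integrals with y = (z/L)² and ν = 17/6 - 5/2 = 1/3. With E the integral of
t^(ν-1)e^(-t-y/t) and D the same integral with the extra factor y/t, the horizontal part is a
multiple of Γ(ν) - E and the vertical part the same multiple of Γ(ν) + E - 2D. Their sum is
proportional to Γ(ν) - D (`norm_gradKernelR_sq_add`).

Finally E is a Bessel function: E/Γ(ν) is the Matérn kernel at 2z/L. Integration by parts, E_(ν+1) =
νE_ν + D, turns 1 - D/Γ(ν) into 1 + νM_ν - νM_(ν+1). Since u·e^(-u) is bounded and vanishes both at
u = 0 and at infinity, dominated convergence gives D → 0 at the wall and far from it, which yields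
both limits. -/

noncomputable section

/-! ### The L² Fourier transform: duality, isometries, conjugation -/

section FourierL2

set_option linter.unusedSectionVars false

open SchwartzMap FourierTransform
open scoped ContDiff

variable {V : Type*} [NormedAddCommGroup V] [InnerProductSpace ℝ V] [FiniteDimensional ℝ V]
  [MeasurableSpace V] [BorelSpace V]

theorem Lp.integral_fourier_mul (h : Lp (α := V) ℂ 2) (s : 𝓢(V, ℂ)) :
    ∫ k, (𝓕 h : Lp (α := V) ℂ 2) k * s k = ∫ x, h x * 𝓕 s x := by
  have := congrArg (fun T : 𝓢'(V, ℂ) => T s) (Lp.fourier_toTemperedDistribution_eq h)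
  simp only [TemperedDistribution.fourier_apply, Lp.toTemperedDistribution_apply, smul_eq_mul] at this
  simpa only [mul_comm] using this.symm

theorem Lp.integral_fourierInv_mul (h : Lp (α := V) ℂ 2) (s : 𝓢(V, ℂ)) :
    ∫ k, (𝓕⁻ h : Lp (α := V) ℂ 2) k * s k = ∫ x, h x * 𝓕⁻ s x := by
  have := congrArg (fun T : 𝓢'(V, ℂ) => T s) (Lp.fourierInv_toTemperedDistribution_eq h)
  simp only [TemperedDistribution.fourierInv_apply, Lp.toTemperedDistribution_apply,
    smul_eq_mul] at this
  simpa only [mul_comm] using this.symm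

/-- A smooth compactly supported real function, as a complex Schwartz function. -/
def schwartzOfReal (g : V → ℝ) (hg : ContDiff ℝ ∞ g) (hc : HasCompactSupport g) : 𝓢(V, ℂ) :=
  HasCompactSupport.toSchwartzMap (f := fun x => (g x : ℂ))
    (hc.comp_left (g := fun t : ℝ => (t : ℂ)) Complex.ofReal_zero)
    (Complex.ofRealCLM.contDiff.comp hg)

@[simp]
theorem schwartzOfReal_apply (g : V → ℝ) (hg : ContDiff ℝ ∞ g) (hc : HasCompactSupport g) (x : V) :
    schwartzOfReal g hg hc x = (g x : ℂ) := rfl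

theorem ae_eq_of_integral_mul_schwartz {f g : V → ℂ} (hf : LocallyIntegrable f)
    (hg : LocallyIntegrable g) (h : ∀ s : 𝓢(V, ℂ), ∫ x, f x * s x = ∫ x, g x * s x) :
    f =ᵐ[volume] g := by
  apply ae_eq_of_integral_contDiff_smul_eq hf hg
  intro η hη hc
  have := h (schwartzOfReal η hη hc)
  simpa [mul_comm] using this

theorem MemLp.locallyIntegrable_two {f : V → ℂ} (hf : MemLp f 2) : LocallyIntegrable f :=
  hf.locallyIntegrable (by norm_num)

/-- The L² Fourier transform has no pointwise formula, so it is identified through its pairings with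
Schwartz functions. Only local integrability of the candidate is required, since a product with an
unbounded symbol is not known to be in L² in advance. -/
theorem Lp.fourier_ae_eq {h : Lp (α := V) ℂ 2} {g : V → ℂ} (hg : LocallyIntegrable g)
    (H : ∀ s : 𝓢(V, ℂ), ∫ x, h x * 𝓕 s x = ∫ x, g x * s x) :
    (𝓕 h : Lp (α := V) ℂ 2) =ᵐ[volume] g := by
  refine ae_eq_of_integral_mul_schwartz (MemLp.locallyIntegrable_two (Lp.memLp _)) hg fun s => ?_
  rw [Lp.integral_fourier_mul, H]

/-- Composition of an `L²` function with a linear isometry. -/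
def Lp.compIsometry (A : V ≃ₗᵢ[ℝ] V) : Lp (α := V) ℂ 2 →ₗᵢ[ℂ] Lp (α := V) ℂ 2 :=
  Lp.compMeasurePreservingₗᵢ ℂ A A.measurePreserving

theorem Lp.coeFn_compIsometry (A : V ≃ₗᵢ[ℝ] V) (h : Lp (α := V) ℂ 2) :
    Lp.compIsometry A h =ᵐ[volume] fun x => h (A x) :=
  Lp.coeFn_compMeasurePreserving h A.measurePreserving

theorem Lp.compIsometry_compIsometry (A : V ≃ₗᵢ[ℝ] V) (hA : ∀ x, A (A x) = x)
    (h : Lp (α := V) ℂ 2) : Lp.compIsometry A (Lp.compIsometry A h) = h := by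
  apply Lp.ext
  filter_upwards [Lp.coeFn_compIsometry A (Lp.compIsometry A h),
    A.measurePreserving.quasiMeasurePreserving.ae (Lp.coeFn_compIsometry A h)] with x h1 h2
  rw [h1, h2, hA]

/-- Composition of a Schwartz function with a linear isometry. -/
def SchwartzMap.compIsometry (A : V ≃ₗᵢ[ℝ] V) : 𝓢(V, ℂ) →L[ℂ] 𝓢(V, ℂ) :=
  compCLMOfContinuousLinearEquiv ℂ (A : V ≃L[ℝ] V)

@[simp]
theorem SchwartzMap.compIsometry_apply (A : V ≃ₗᵢ[ℝ] V) (s : 𝓢(V, ℂ)) (x : V) :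
    SchwartzMap.compIsometry A s x = s (A x) := rfl

theorem SchwartzMap.fourier_compIsometry (A : V ≃ₗᵢ[ℝ] V) (s : 𝓢(V, ℂ)) :
    𝓕 (SchwartzMap.compIsometry A s) = SchwartzMap.compIsometry A (𝓕 s) := by
  ext k
  rw [SchwartzMap.compIsometry_apply, fourier_coe, fourier_coe]
  exact Real.fourier_comp_linearIsometry A s k

theorem Lp.fourier_compIsometry (A : V ≃ₗᵢ[ℝ] V) (h : Lp (α := V) ℂ 2) :
    𝓕 (Lp.compIsometry A h) = Lp.compIsometry A (𝓕 h) := by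
  apply Lp.ext
  refine Lp.fourier_ae_eq (MemLp.locallyIntegrable_two (Lp.memLp _)) fun s => ?_
  have key : ∀ (f : Lp (α := V) ℂ 2) (s : 𝓢(V, ℂ)), ∫ x, Lp.compIsometry A f x * s x =
      ∫ x, f x * SchwartzMap.compIsometry A.symm s x := by
    intro f s
    rw [← A.measurePreserving.integral_comp A.toHomeomorph.measurableEmbedding
      (fun x => f x * SchwartzMap.compIsometry A.symm s x)]
    apply integral_congr_ae
    filter_upwards [Lp.coeFn_compIsometry A f] with x hx
    simp [hx]
  rw [key, key, ← SchwartzMap.fourier_compIsometry, Lp.integral_fourier_mul]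

/-- The complex conjugate of a Schwartz function. -/
def SchwartzMap.conj (s : 𝓢(V, ℂ)) : 𝓢(V, ℂ) :=
  SchwartzMap.postcompCLM (𝕜 := ℝ) (Complex.conjCLE : ℂ →L[ℝ] ℂ) s

@[simp]
theorem SchwartzMap.conj_apply (s : 𝓢(V, ℂ)) (x : V) : s.conj x = star (s x) := rfl

theorem SchwartzMap.fourier_conj (s : 𝓢(V, ℂ)) (k : V) :
    𝓕 s.conj k = star (𝓕 s (-k)) := by
  rw [fourier_coe, fourier_coe, Real.fourier_eq, Real.fourier_eq,
    show ∀ z : ℂ, star z = (starRingEnd ℂ) z from fun _ => rfl, ← integral_conj]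
  congr 1
  ext x
  simp [Circle.smul_def, Real.fourierChar_apply, ← Complex.exp_conj, map_ofNat]

/-- Conjugation commutes with the Fourier transform up to k ↦ -k; the identity is moved from
Schwartz functions to L² by duality. -/
theorem Lp.fourier_star (h : Lp (α := V) ℂ 2) :
    (𝓕 (star h) : Lp (α := V) ℂ 2) =ᵐ[volume] fun k => star ((𝓕 h : Lp (α := V) ℂ 2) (-k)) := by
  have h1 : ∀ g : Lp (α := V) ℂ 2,
      (star (Lp.compIsometry (LinearIsometryEquiv.neg ℝ) g) : Lp (α := V) ℂ 2) =ᵐ[volume]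
        fun k => star (g (-k)) := by
    intro g
    filter_upwards [Lp.coeFn_star (Lp.compIsometry (LinearIsometryEquiv.neg ℝ) g),
      Lp.coeFn_compIsometry (LinearIsometryEquiv.neg ℝ) g] with k hk hk'
    rw [hk, Pi.star_apply, hk']
    simp
  specialize h1 (𝓕 h)
  refine (Lp.fourier_ae_eq (MemLp.locallyIntegrable_two (Lp.memLp _)) fun s => ?_).trans h1
  have e1 : ∫ x, (star h : Lp (α := V) ℂ 2) x * 𝓕 s x =
      star (∫ x, h x * 𝓕 (SchwartzMap.compIsometry (LinearIsometryEquiv.neg ℝ) s.conj) x) := by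
    rw [show ∀ z : ℂ, star z = (starRingEnd ℂ) z from fun _ => rfl, ← integral_conj]
    apply integral_congr_ae
    filter_upwards [Lp.coeFn_star h] with x hx
    rw [hx, SchwartzMap.fourier_compIsometry, SchwartzMap.compIsometry_apply,
      SchwartzMap.fourier_conj]
    simp
  have e2 := integral_congr_ae (h1.mul (ae_eq_refl s))
  simp only [Pi.mul_apply] at e2
  rw [e1, ← Lp.integral_fourier_mul, e2, ← integral_neg_eq_self]
  rw [show ∀ z : ℂ, star z = (starRingEnd ℂ) z from fun _ => rfl, ← integral_conj]
  simp

/-- A function whose Fourier transform is Hermitian is real. -/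
theorem Lp.star_eq_self_of_fourier {h : Lp (α := V) ℂ 2}
    (H : ∀ᵐ k, (𝓕 h : Lp (α := V) ℂ 2) (-k) = star ((𝓕 h : Lp (α := V) ℂ 2) k)) : star h = h := by
  apply (Lp.fourierTransformₗᵢ V ℂ).injective
  apply Lp.ext
  refine (Lp.fourier_star h).trans ?_
  filter_upwards [H] with k hk
  rw [hk, star_star]; rfl

end FourierL2

/-! ### Odd reflection and the sine transform -/

section HalfSpace

open SchwartzMap FourierTransform

/-- Complex square-integrable functions on the whole space. -/
abbrev L2F : Type := Lp ℂ 2 (volume : Measure E3)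

/-- The reflection in the plane `z = 0`. -/
def reflZ : E3 ≃ₗᵢ[ℝ] E3 :=
  LinearIsometryEquiv.piLpCongrRight 2
    fun i : Fin 3 => if i = 2 then LinearIsometryEquiv.neg ℝ else LinearIsometryEquiv.refl ℝ ℝ

@[simp]
theorem reflZ_apply (x : E3) (i : Fin 3) : reflZ x i = if i = 2 then - x i else x i := by
  simp only [reflZ, LinearIsometryEquiv.piLpCongrRight_apply]
  split_ifs <;> rfl

@[simp]
theorem reflZ_reflZ (x : E3) : reflZ (reflZ x) = x := by
  ext i
  simp only [reflZ_apply]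
  split_ifs <;> simp

theorem mem_halfSpace {x : E3} : x ∈ (halfSpace : Set E3) ↔ 0 < x 2 := Iff.rfl

theorem measurableSet_halfSpace : MeasurableSet (halfSpace : Set E3) :=
  halfSpace.isOpen.measurableSet

theorem reflZ_mem_halfSpace {x : E3} : reflZ x ∈ (halfSpace : Set E3) ↔ x 2 < 0 := by
  rw [mem_halfSpace]
  simp

theorem ae_coord_two_ne_zero : ∀ᵐ x : E3, x 2 ≠ 0 := by
  have h : volume ((LinearMap.ker (EuclideanSpace.proj (𝕜 := ℝ) (2 : Fin 3)).toLinearMap :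
      Submodule ℝ E3) : Set E3) = 0 := by
    apply Measure.addHaar_submodule
    intro h
    have : e3 2 ∈ LinearMap.ker (EuclideanSpace.proj (𝕜 := ℝ) (2 : Fin 3)).toLinearMap := by
      rw [h]; trivial
    simp [e3] at this
  rw [ae_iff]
  convert h using 2
  ext x
  simp

/-- Restriction to the half-space. -/
def resH : L2F →L[ℂ] L2C := LpToLpRestrictCLM E3 ℂ ℂ volume 2 (halfSpace : Set E3)

theorem coeFn_resH (h : L2F) : resH h =ᵐ[volH] h :=
  LpToLpRestrictCLM_coeFn ℂ (halfSpace : Set E3) h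

theorem memLp_indicator_halfSpace (φ : L2C) : MemLp ((halfSpace : Set E3).indicator φ) 2 :=
  (memLp_indicator_iff_restrict measurableSet_halfSpace).2 (Lp.memLp φ)

/-- Extension by zero from the half-space. -/
def extH : L2C →ₗᵢ[ℂ] L2F where
  toFun φ := (memLp_indicator_halfSpace φ).toLp _
  map_add' φ ψ := by
    rw [← MemLp.toLp_add]
    apply MemLp.toLp_congr
    filter_upwards [(ae_restrict_iff' measurableSet_halfSpace).1 (Lp.coeFn_add φ ψ)] with x hx
    by_cases h : x ∈ (halfSpace : Set E3)
    · simp only [Pi.add_apply, Set.indicator_of_mem h, hx h]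
    · simp only [Pi.add_apply, Set.indicator_of_notMem h, add_zero]
  map_smul' c φ := by
    rw [← MemLp.toLp_const_smul]
    apply MemLp.toLp_congr
    filter_upwards [(ae_restrict_iff' measurableSet_halfSpace).1 (Lp.coeFn_smul c φ)] with x hx
    by_cases h : x ∈ (halfSpace : Set E3)
    · simp only [Pi.smul_apply, Set.indicator_of_mem h, hx h, RingHom.id_apply]
    · simp only [Pi.smul_apply, Set.indicator_of_notMem h, smul_zero]
  norm_map' φ := by
    change ‖(memLp_indicator_halfSpace φ).toLp _‖ = ‖φ‖
    rw [Lp.norm_toLp, eLpNorm_indicator_eq_eLpNorm_restrict measurableSet_halfSpace]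
    rfl

theorem coeFn_extH (φ : L2C) : extH φ =ᵐ[volume] (halfSpace : Set E3).indicator φ :=
  (memLp_indicator_halfSpace φ).coeFn_toLp

/-- Odd extension from the half-space to the whole space. -/
def oddExt : L2C →ₗ[ℂ] L2F :=
  extH.toLinearMap - (Lp.compIsometry reflZ).toLinearMap ∘ₗ extH.toLinearMap

theorem oddExt_apply (φ : L2C) : oddExt φ = extH φ - Lp.compIsometry reflZ (extH φ) := rfl

theorem coeFn_oddExt (φ : L2C) : oddExt φ =ᵐ[volume] fun x =>
    (halfSpace : Set E3).indicator φ x - (halfSpace : Set E3).indicator φ (reflZ x) := by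
  rw [oddExt_apply]
  filter_upwards [Lp.coeFn_sub (extH φ) (Lp.compIsometry reflZ (extH φ)), coeFn_extH φ,
    Lp.coeFn_compIsometry reflZ (extH φ),
    reflZ.measurePreserving.quasiMeasurePreserving.ae (coeFn_extH φ)] with x h1 h2 h3 h4
  rw [h1, Pi.sub_apply, h2, h3, h4]

theorem compIsometry_oddExt (φ : L2C) : Lp.compIsometry reflZ (oddExt φ) = - oddExt φ := by
  rw [oddExt_apply, map_sub, Lp.compIsometry_compIsometry _ reflZ_reflZ, neg_sub]

theorem resH_oddExt (φ : L2C) : resH (oddExt φ) = φ := by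
  apply Lp.ext
  refine (coeFn_resH _).trans ?_
  refine (ae_restrict_iff' measurableSet_halfSpace).2 ?_
  filter_upwards [coeFn_oddExt φ] with x hx hm
  rw [hx, Set.indicator_of_mem hm, Set.indicator_of_notMem, sub_zero]
  rw [reflZ_mem_halfSpace, not_lt]
  exact (mem_halfSpace.1 hm).le

/-- An odd function is determined by its restriction to the half-space, because the plane z = 0 is a
null set. -/
theorem oddExt_resH {h : L2F} (hh : Lp.compIsometry reflZ h = -h) : oddExt (resH h) = h := by
  have hodd : ∀ᵐ x, h (reflZ x) = - h x := by
    filter_upwards [Lp.coeFn_compIsometry reflZ h, Lp.coeFn_neg h] with x h1 h2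
    rw [← h1, hh, h2, Pi.neg_apply]
  have hres : ∀ᵐ x, x ∈ (halfSpace : Set E3) → resH h x = h x :=
    (ae_restrict_iff' measurableSet_halfSpace).1 (coeFn_resH h)
  apply Lp.ext
  filter_upwards [coeFn_oddExt (resH h), hodd, hres,
    reflZ.measurePreserving.quasiMeasurePreserving.ae hres, ae_coord_two_ne_zero]
    with x h1 h2 h3 h4 h5
  rw [h1]
  rcases lt_or_gt_of_ne h5 with hx | hx
  · rw [Set.indicator_of_notMem (by rw [mem_halfSpace]; exact hx.not_gt),
      Set.indicator_of_mem (reflZ_mem_halfSpace.2 hx), h4 (reflZ_mem_halfSpace.2 hx), h2]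
    ring
  · rw [Set.indicator_of_mem (mem_halfSpace.2 hx), h3 (mem_halfSpace.2 hx),
      Set.indicator_of_notMem (by rw [reflZ_mem_halfSpace]; exact hx.not_gt), sub_zero]

/-- The zero extension and its mirror image have disjoint supports, hence are orthogonal. The factor
2 here cancels the 1/2 of `norm_resH_sq` in the sine transform, making it unitary without
normalization. -/
theorem norm_oddExt_sq (φ : L2C) : ‖oddExt φ‖ ^ 2 = 2 * ‖φ‖ ^ 2 := by
  have h0 : inner ℂ (extH φ) (Lp.compIsometry reflZ (extH φ)) = 0 := by
    rw [L2.inner_def]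
    apply integral_eq_zero_of_ae
    filter_upwards [coeFn_extH φ, Lp.coeFn_compIsometry reflZ (extH φ),
      reflZ.measurePreserving.quasiMeasurePreserving.ae (coeFn_extH φ)] with x h1 h2 h3
    rw [h2, h3, h1]
    by_cases hx : x ∈ (halfSpace : Set E3)
    · rw [Set.indicator_of_notMem (s := (halfSpace : Set E3)) (a := reflZ x), inner_zero_right]
      · rfl
      · rw [reflZ_mem_halfSpace]; exact not_lt.2 (mem_halfSpace.1 hx).le
    · rw [Set.indicator_of_notMem hx, inner_zero_left]; rfl
  rw [oddExt_apply, norm_sub_sq (𝕜 := ℂ), h0, LinearIsometry.norm_map, LinearIsometry.norm_map]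
  simp
  ring

theorem norm_resH_sq {h : L2F} (hh : Lp.compIsometry reflZ h = -h) :
    ‖resH h‖ ^ 2 = 1 / 2 * ‖h‖ ^ 2 := by
  conv_rhs => rw [← oddExt_resH hh]
  rw [norm_oddExt_sq]; ring

/-- Reflecting the lower half onto the upper one: an odd function only sees the antisymmetric part
of what it is paired with. -/
theorem integral_oddExt_mul (φ : L2C) {w : E3 → ℂ} (hw : MemLp w 2) :
    ∫ x, oddExt φ x * w x = ∫ x, φ x * (w x - w (reflZ x)) ∂volH := by
  have hi1 : ∀ {v : E3 → ℂ}, MemLp v 2 →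
      Integrable (fun x => (halfSpace : Set E3).indicator φ x * v x) := fun hv =>
    MemLp.integrable_mul ((memLp_indicator_iff_restrict measurableSet_halfSpace).2 (Lp.memLp φ)) hv
  have hw' : MemLp (fun x => w (reflZ x)) 2 := hw.comp_measurePreserving reflZ.measurePreserving
  have e2 : ∀ x, (halfSpace : Set E3).indicator φ (reflZ x) * w x =
      (fun y => (halfSpace : Set E3).indicator φ y * w (reflZ y)) (reflZ x) := by
    intro x; simp
  calc ∫ x, oddExt φ x * w x
      = ∫ x, ((halfSpace : Set E3).indicator φ x * w x -
          (halfSpace : Set E3).indicator φ (reflZ x) * w x) := by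
        apply integral_congr_ae
        filter_upwards [coeFn_oddExt φ] with x hx
        rw [hx, sub_mul]
    _ = ∫ x, ((halfSpace : Set E3).indicator φ x * w x -
          (halfSpace : Set E3).indicator φ x * w (reflZ x)) := by
        simp_rw [e2]
        rw [integral_sub (hi1 hw), integral_sub (hi1 hw) (hi1 hw'),
          reflZ.measurePreserving.integral_comp reflZ.toHomeomorph.measurableEmbedding
            (fun y => (halfSpace : Set E3).indicator φ y * w (reflZ y))]
        exact reflZ.measurePreserving.integrable_comp_of_integrable (hi1 hw')
    _ = ∫ x, (halfSpace : Set E3).indicator (fun x => φ x * (w x - w (reflZ x))) x := by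
        congr 1; ext x
        by_cases hx : x ∈ (halfSpace : Set E3)
        · simp only [Set.indicator_of_mem hx]; ring
        · simp only [Set.indicator_of_notMem hx]; ring
    _ = _ := integral_indicator measurableSet_halfSpace

theorem compIsometry_fourier_oddExt (φ : L2C) :
    Lp.compIsometry reflZ (𝓕 (oddExt φ)) = -(𝓕 (oddExt φ) : L2F) := by
  rw [← Lp.fourier_compIsometry, compIsometry_oddExt]
  exact (Lp.fourierTransformₗᵢ E3 ℂ).map_neg _

theorem compIsometry_fourierInv {h : L2F} (hh : Lp.compIsometry reflZ h = -h) :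
    Lp.compIsometry reflZ (𝓕⁻ h) = -(𝓕⁻ h : L2F) := by
  apply (Lp.fourierTransformₗᵢ E3 ℂ).injective
  rw [map_neg]
  change 𝓕 (Lp.compIsometry reflZ (𝓕⁻ h)) = -𝓕 (𝓕⁻ h : L2F)
  rw [Lp.fourier_compIsometry, FourierTransform.fourier_fourierInv_eq, hh]

/-- The sine transform: Fourier transform of the odd extension, as a unitary map on the square
integrable functions on the half-space. -/
def sineTransform : L2C ≃ₗᵢ[ℂ] L2C where
  toFun φ := resH (𝓕 (oddExt φ))
  invFun φ := resH (𝓕⁻ (oddExt φ))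
  map_add' φ ψ := by rw [map_add, FourierTransform.fourier_add, map_add]
  map_smul' c φ := by rw [map_smul, FourierTransform.fourier_smul, map_smul, RingHom.id_apply]
  left_inv φ := by
    change resH (𝓕⁻ (oddExt (resH (𝓕 (oddExt φ))))) = φ
    rw [oddExt_resH (compIsometry_fourier_oddExt φ), FourierTransform.fourierInv_fourier_eq,
      resH_oddExt]
  right_inv φ := by
    change resH (𝓕 (oddExt (resH (𝓕⁻ (oddExt φ))))) = φ
    rw [oddExt_resH (compIsometry_fourierInv (compIsometry_oddExt φ)),
      FourierTransform.fourier_fourierInv_eq, resH_oddExt]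
  norm_map' φ := by
    change ‖resH (𝓕 (oddExt φ))‖ = ‖φ‖
    rw [← sq_eq_sq₀ (norm_nonneg _) (norm_nonneg _), norm_resH_sq (compIsometry_fourier_oddExt φ),
      Lp.norm_fourier_eq, norm_oddExt_sq]
    ring

theorem sineTransform_apply (φ : L2C) : sineTransform φ = resH (𝓕 (oddExt φ)) := rfl

theorem oddExt_sineTransform (φ : L2C) : oddExt (sineTransform φ) = 𝓕 (oddExt φ) :=
  oddExt_resH (compIsometry_fourier_oddExt φ)

end HalfSpace

/-! ### Green's formula for Schwartz functions on the half-space -/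

section WeakDerivatives

open SchwartzMap FourierTransform
open scoped ContDiff

theorem TestFunction.lineDerivOp_apply_eq_fderiv {Ω : TopologicalSpace.Opens E3} (η : 𝓓(Ω, ℝ))
    (v x : E3) : (∂_{v} η) x = fderiv ℝ η x v := by
  rw [TestFunction.lineDerivOp_eq_lineDerivCLM (𝕜 := ℝ), TestFunction.lineDerivCLM_apply_of_le
    (by simp)]
  exact (η.contDiff.differentiable (by simp)).differentiableAt.lineDeriv_eq_fderiv

instance : IsFiniteMeasureOnCompacts volH :=
  inferInstanceAs (IsFiniteMeasureOnCompacts (volume.restrict (halfSpace : Set E3)))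

theorem SchwartzMap.memLp_volH (s : 𝓢(E3, ℂ)) : MemLp s 2 volH :=
  (s.memLp 2 volume).restrict (halfSpace : Set E3)

theorem integrable_Lp_mul {α : Type*} [MeasurableSpace α] {m : Measure α} (φ : Lp ℂ 2 m) {w : α → ℂ} (hw : MemLp w 2 m) :
    Integrable (fun x => φ x * w x) m :=
  MemLp.integrable_mul (Lp.memLp _) hw

theorem MemLp.complex_ofReal {α : Type*} [MeasurableSpace α] {m : Measure α} {w : α → ℝ}
    (hw : MemLp w 2 m) : MemLp (fun x => (w x : ℂ)) 2 m := hw.ofReal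

/-- Passage to the limit in Green's formula along a sequence of cutoff functions. -/
theorem green_of_cutoff {φ g : L2C} {v : E3} {w B : E3 → ℝ} {θ : ℕ → E3 → ℝ}
    (hw : Differentiable ℝ w) (hθ : ∀ n, ContDiff ℝ 1 (θ n)) (hwL : MemLp w 2 volH)
    (hdw : MemLp (fun x => fderiv ℝ w x v) 2 volH) (hB : MemLp B 2 volH)
    (hθ1 : ∀ n x, |θ n x| ≤ 1)
    (hθlim : ∀ x ∈ halfSpace, Tendsto (fun n => θ n x) atTop (𝓝 1))
    (hdθ : ∀ n, ∀ x ∈ halfSpace, |w x * fderiv ℝ (θ n) x v| ≤ B x)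
    (hdθlim : ∀ x ∈ halfSpace, Tendsto (fun n => w x * fderiv ℝ (θ n) x v) atTop (𝓝 0))
    (H : ∀ n, ∫ x, φ x * ((fderiv ℝ (fun y => θ n y * w y) x v : ℝ) : ℂ) ∂volH =
      - ∫ x, g x * ((θ n x * w x : ℝ) : ℂ) ∂volH) :
    ∫ x, φ x * ((fderiv ℝ w x v : ℝ) : ℂ) ∂volH = - ∫ x, g x * (w x : ℂ) ∂volH := by
  have hmem : ∀ᵐ x ∂volH, x ∈ halfSpace := ae_restrict_mem measurableSet_halfSpace
  have hd : ∀ n x, fderiv ℝ (fun y => θ n y * w y) x v =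
      θ n x * fderiv ℝ w x v + w x * fderiv ℝ (θ n) x v := by
    intro n x
    rw [fderiv_fun_mul ((hθ n).differentiable (by simp)).differentiableAt (hw x)]
    simp
  have m1 : ∀ n, MemLp (fun x => θ n x * fderiv ℝ w x v) 2 volH := fun n =>
    hdw.of_le ((hθ n).continuous.aestronglyMeasurable.mul hdw.1) (Eventually.of_forall fun x => by
      rw [norm_mul]
      exact mul_le_of_le_one_left (norm_nonneg _) (hθ1 n x))
  have m2 : ∀ n, MemLp (fun x => w x * fderiv ℝ (θ n) x v) 2 volH := fun n =>
    hB.of_le (hwL.1.mul (((hθ n).continuous_fderiv (by simp)).clm_apply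
      continuous_const).aestronglyMeasurable) (by
        filter_upwards [hmem] with x hx
        exact (hdθ n x hx).trans (le_abs_self _))
  have L1 : Tendsto (fun n => ∫ x, φ x * ((fderiv ℝ (fun y => θ n y * w y) x v : ℝ) : ℂ) ∂volH)
      atTop (𝓝 (∫ x, φ x * ((fderiv ℝ w x v : ℝ) : ℂ) ∂volH)) := by
    apply tendsto_integral_of_dominated_convergence
      (fun x => ‖φ x‖ * (|fderiv ℝ w x v| + B x))
    · intro n
      simp only [hd]
      exact (integrable_Lp_mul φ (MemLp.complex_ofReal ((m1 n).add (m2 n)))).1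
    · exact MemLp.integrable_mul (Lp.memLp φ).norm (hdw.abs.add hB)
    · intro n
      filter_upwards [hmem] with x hx
      rw [norm_mul, Complex.norm_real, hd]
      refine mul_le_mul_of_nonneg_left ((norm_add_le _ _).trans (add_le_add ?_ (hdθ n x hx)))
        (norm_nonneg _)
      rw [norm_mul]
      exact mul_le_of_le_one_left (norm_nonneg _) (hθ1 n x)
    · filter_upwards [hmem] with x hx
      apply Tendsto.const_mul
      apply (Complex.continuous_ofReal.tendsto _).comp
      simp only [hd]
      simpa using ((hθlim x hx).mul_const (fderiv ℝ w x v)).add (hdθlim x hx)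
  have L2 : Tendsto (fun n => - ∫ x, g x * ((θ n x * w x : ℝ) : ℂ) ∂volH)
      atTop (𝓝 (- ∫ x, g x * (w x : ℂ) ∂volH)) := by
    apply Tendsto.neg
    apply tendsto_integral_of_dominated_convergence (fun x => ‖g x‖ * |w x|)
    · intro n
      exact (integrable_Lp_mul g (MemLp.complex_ofReal (hwL.of_le
        ((hθ n).continuous.aestronglyMeasurable.mul hwL.1) (Eventually.of_forall fun x => by
          rw [Pi.mul_apply, norm_mul]
          exact mul_le_of_le_one_left (norm_nonneg _) (hθ1 n x))))).1
    · exact MemLp.integrable_mul (Lp.memLp g).norm hwL.abs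
    · refine fun n => Eventually.of_forall fun x => ?_
      rw [norm_mul, Complex.norm_real, norm_mul]
      exact mul_le_mul_of_nonneg_left (mul_le_of_le_one_left (norm_nonneg _) (hθ1 n x))
        (norm_nonneg _)
    · filter_upwards [hmem] with x hx
      apply Tendsto.const_mul
      apply (Complex.continuous_ofReal.tendsto _).comp
      simpa using (hθlim x hx).mul_const (w x)
  simp only [H] at L1
  exact tendsto_nhds_unique L1 L2

/-- Green's formula for a weak partial derivative and a compactly supported smooth function that
vanishes on the boundary plane. -/
theorem IsWeakPartial.green_of_hasCompactSupport {i : Fin 3} {φ g : L2C}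
    (h : IsWeakPartial i φ g) {w : E3 → ℝ} (hw : ContDiff ℝ ∞ w) (hc : HasCompactSupport w)
    (h0 : ∀ x : E3, x 2 = 0 → w x = 0) :
    ∫ x, φ x * ((fderiv ℝ w x (e3 i) : ℝ) : ℂ) ∂volH = - ∫ x, g x * (w x : ℂ) ∂volH := by
  obtain ⟨C, hC⟩ : ∃ C, ∀ t, ‖deriv Real.smoothTransition t‖ ≤ C := by
    have hcont : Continuous (deriv Real.smoothTransition) :=
      (Real.smoothTransition.contDiff (n := 1)).continuous_deriv le_rfl
    refine HasCompactSupport.exists_bound_of_continuous ?_ hcont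
    refine HasCompactSupport.intro (isCompact_Icc (a := (0 : ℝ)) (b := 1)) fun t ht => ?_
    rw [Set.mem_Icc, not_and_or, not_le, not_le] at ht
    rcases ht with ht | ht
    · have : Real.smoothTransition =ᶠ[𝓝 t] fun _ => 0 := by
        filter_upwards [gt_mem_nhds ht] with y hy
        exact Real.smoothTransition.zero_of_nonpos hy.le
      rw [this.deriv_eq, deriv_const]
    · have : Real.smoothTransition =ᶠ[𝓝 t] fun _ => 1 := by
        filter_upwards [lt_mem_nhds ht] with y hy
        exact Real.smoothTransition.one_of_one_le hy.le
      rw [this.deriv_eq, deriv_const]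
  obtain ⟨K, hK⟩ := ContDiff.lipschitzWith_of_hasCompactSupport hc hw (by simp)
  -- Compare with the foot of the perpendicular on the plane, where the function vanishes.
  have hwz : ∀ x : E3, |w x| ≤ K * |x 2| := by
    intro x
    have h1 := hK.dist_le_mul x (x - x 2 • e3 2)
    rw [h0 (x - x 2 • e3 2) (by simp [e3]), Real.dist_0_eq_abs] at h1
    simpa [dist_eq_norm, norm_smul, e3] using h1
  -- The cutoff is 0 for z ≤ 1/(n+1) and 1 for z ≥ 2/(n+1), so multiplying by it gives test
  -- functions supported inside the open half-space.
  set θ : ℕ → E3 → ℝ := fun n x => Real.smoothTransition ((n + 1) * x 2 - 1) with hθdef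
  have hθ : ∀ n, ContDiff ℝ ∞ (θ n) := fun n =>
    Real.smoothTransition.contDiff.comp (by fun_prop)
  have hdθ : ∀ n x v, fderiv ℝ (θ n) x v =
      deriv Real.smoothTransition ((n + 1) * x 2 - 1) * ((n + 1) * v 2) := by
    intro n x v
    have h1 : HasDerivAt Real.smoothTransition (deriv Real.smoothTransition ((n + 1) * x 2 - 1))
        ((n + 1) * x 2 - 1) :=
      ((Real.smoothTransition.contDiff (n := 1)).differentiable one_ne_zero _).hasDerivAt
    have h2 : HasFDerivAt (fun y : E3 => (n + 1 : ℝ) * y 2 - 1)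
        ((n + 1 : ℝ) • (EuclideanSpace.proj (𝕜 := ℝ) (2 : Fin 3) : E3 →L[ℝ] ℝ)) x :=
      (((EuclideanSpace.proj (𝕜 := ℝ) (2 : Fin 3)).hasFDerivAt (x := x)).const_mul
        (n + 1 : ℝ)).sub_const 1
    have h3 := (h1.comp_hasFDerivAt x h2).fderiv
    change fderiv ℝ (Real.smoothTransition ∘ fun y : E3 => (n + 1 : ℝ) * y 2 - 1) x v = _
    rw [h3]
    simp
  have hdw : Continuous fun x => fderiv ℝ w x (e3 i) :=
    (hw.continuous_fderiv (by simp)).clm_apply continuous_const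
  -- The derivative of the cutoff is of size C(n+1), but on the half-space it is nonzero only where
  -- (n+1)z ≤ 2. There |w| ≤ Kz, so the product is at most 2CK uniformly in n: vanishing on the
  -- plane compensates the steep cutoff.
  have hB : MemLp ((tsupport w).indicator fun _ => C * K * 2 * |(e3 i) 2|) 2 volH :=
    (memLp_indicator_const 2 (isClosed_tsupport w).measurableSet _ (Or.inr
      ((Measure.restrict_apply_le _ _).trans_lt hc.isCompact.measure_lt_top).ne))
  have hT : ∀ t, 1 < t → deriv Real.smoothTransition t = 0 := by
    intro t ht
    have : Real.smoothTransition =ᶠ[𝓝 t] fun _ => 1 := by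
      filter_upwards [lt_mem_nhds ht] with y hy
      exact Real.smoothTransition.one_of_one_le hy.le
    rw [this.deriv_eq, deriv_const]
  refine green_of_cutoff (θ := θ) (hw.differentiable (by simp)) (fun n => (hθ n).of_le (by simp))
    (hw.continuous.memLp_of_hasCompactSupport hc)
    (hdw.memLp_of_hasCompactSupport (hc.fderiv_apply (𝕜 := ℝ) (e3 i))) hB ?_ ?_ ?_ ?_ ?_
  · intro n x
    rw [abs_of_nonneg (Real.smoothTransition.nonneg _)]
    exact Real.smoothTransition.le_one _
  · intro x hx
    have hx : 0 < x 2 := hx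
    apply tendsto_const_nhds.congr'
    filter_upwards [(tendsto_natCast_atTop_atTop (R := ℝ)).eventually_ge_atTop (2 / x 2)] with n hn
    rw [div_le_iff₀ hx] at hn
    exact (Real.smoothTransition.one_of_one_le (by linarith)).symm
  · intro n x hx
    have hx : 0 < x 2 := hx
    by_cases hxs : x ∈ tsupport w
    · rw [Set.indicator_of_mem hxs, hdθ]
      by_cases hc : 1 < (n + 1) * x 2 - 1
      · rw [hT _ hc]
        simp only [zero_mul, mul_zero, abs_zero]
        have := (norm_nonneg _).trans (hC 0)
        positivity
      · have h1 := hwz x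
        rw [abs_of_pos hx] at h1
        rw [abs_mul, abs_mul, abs_mul, abs_of_pos (by positivity : (0 : ℝ) < n + 1)]
        calc |w x| * (|deriv Real.smoothTransition ((n + 1) * x 2 - 1)| * ((n + 1) * |(e3 i) 2|))
            ≤ (K * x 2) * (C * ((n + 1) * |(e3 i) 2|)) := by
              gcongr
              exact hC _
          _ = C * K * ((n + 1) * x 2) * |(e3 i) 2| := by ring
          _ ≤ _ := by
            have := (norm_nonneg _).trans (hC 0)
            gcongr
            linarith
    · rw [image_eq_zero_of_notMem_tsupport hxs, zero_mul, abs_zero,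
        Set.indicator_of_notMem hxs]
  · intro x hx
    have hx : 0 < x 2 := hx
    apply tendsto_const_nhds.congr'
    filter_upwards [(tendsto_natCast_atTop_atTop (R := ℝ)).eventually_ge_atTop (2 / x 2)] with n hn
    rw [div_le_iff₀ hx] at hn
    rw [hdθ, hT _ (by linarith)]
    simp
  · intro n
    have hsub : Function.support (fun x => θ n x * w x) ⊆ {x : E3 | 1 ≤ (n + 1) * x 2} := by
      intro x hx
      by_contra hcon
      apply hx
      simp only [Set.mem_ofPred_eq, not_le] at hcon
      simp only [hθdef]
      rw [Real.smoothTransition.zero_of_nonpos (by linarith), zero_mul]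
    let η : 𝓓(halfSpace, ℝ) := ⟨fun x => θ n x * w x, (hθ n).mul hw, hc.mul_left,
      (closure_minimal hsub (isClosed_le (by fun_prop) (by fun_prop))).trans fun x hx => by
        have hx : (1 : ℝ) ≤ (n + 1) * x 2 := hx
        rw [mem_halfSpace]
        by_contra hcon
        have : ((n : ℝ) + 1) * x 2 ≤ 0 :=
          mul_nonpos_of_nonneg_of_nonpos (by positivity) (not_lt.1 hcon)
        linarith⟩
    have := h η
    simp only [TestFunction.lineDerivOp_apply_eq_fderiv] at this
    exact this

/-- Extension of Green's formula from compactly supported functions to Schwartz functions. -/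
theorem green_schwartz {φ g : L2C} {v : E3} {Z : Set E3}
    (H : ∀ w : E3 → ℝ, ContDiff ℝ ∞ w → HasCompactSupport w → (∀ x ∈ Z, w x = 0) →
      ∫ x, φ x * ((fderiv ℝ w x v : ℝ) : ℂ) ∂volH = - ∫ x, g x * (w x : ℂ) ∂volH)
    (s : 𝓢(E3, ℂ)) (hs : ∀ x ∈ Z, s x = 0) :
    ∫ x, φ x * (∂_{v} s) x ∂volH = - ∫ x, g x * s x ∂volH := by
  let χ : ContDiffBump (0 : E3) := ⟨1, 2, one_pos, one_lt_two⟩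
  obtain ⟨C, hC⟩ : ∃ C, ∀ x, ‖fderiv ℝ χ x‖ ≤ C :=
    (χ.hasCompactSupport.fderiv ℝ).exists_bound_of_continuous
      (χ.contDiff (n := 1).continuous_fderiv one_ne_zero)
  have hC0 : 0 ≤ C := (norm_nonneg _).trans (hC 0)
  -- A cutoff at infinity; its derivative is O(1/n), so the error term vanishes in the limit.
  set θ : ℕ → E3 → ℝ := fun n x => χ (((n : ℝ) + 1)⁻¹ • x) with hθdef
  have hθ : ∀ n, ContDiff ℝ ∞ (θ n) := fun n => χ.contDiff.comp (by fun_prop)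
  have hdθ : ∀ n x, |fderiv ℝ (θ n) x v| ≤ C * ‖v‖ * ((n : ℝ) + 1)⁻¹ := by
    intro n x
    have h1 : HasFDerivAt (fun y : E3 => ((n : ℝ) + 1)⁻¹ • y)
        (((n : ℝ) + 1)⁻¹ • ContinuousLinearMap.id ℝ E3) x :=
      (((n : ℝ) + 1)⁻¹ • ContinuousLinearMap.id ℝ E3).hasFDerivAt
    have h2 := (((χ.contDiff (n := 1)).differentiable one_ne_zero _).hasFDerivAt.comp x h1).fderiv
    change |fderiv ℝ (χ ∘ fun y : E3 => ((n : ℝ) + 1)⁻¹ • y) x v| ≤ _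
    rw [h2]
    have h3 := (fderiv ℝ χ (((n : ℝ) + 1)⁻¹ • x)).le_of_opNorm_le (hC _) v
    simp only [ContinuousLinearMap.comp_apply, smul_apply,
      ContinuousLinearMap.id_apply, map_smul, smul_eq_mul, abs_mul]
    rw [abs_of_pos (by positivity), mul_comm]
    gcongr
    exact h3
  have hθc : ∀ n, HasCompactSupport (θ n) := fun n =>
    χ.hasCompactSupport.comp_smul (by positivity)
  have key : ∀ w : E3 → ℝ, ContDiff ℝ ∞ w → MemLp w 2 volH →
      MemLp (fun x => fderiv ℝ w x v) 2 volH → (∀ x ∈ Z, w x = 0) →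
      ∫ x, φ x * ((fderiv ℝ w x v : ℝ) : ℂ) ∂volH = - ∫ x, g x * (w x : ℂ) ∂volH := by
    intro w hw hwL hdwL hwZ
    refine green_of_cutoff (θ := θ) (B := fun x => C * ‖v‖ * |w x|) (hw.differentiable (by simp))
      (fun n => (hθ n).of_le (by simp)) hwL hdwL (hwL.abs.const_mul _) ?_ ?_ ?_ ?_ ?_
    · intro n x
      rw [abs_of_nonneg χ.nonneg]
      exact χ.le_one
    · intro x _
      have h1 : Tendsto (fun n : ℕ => ((n : ℝ) + 1)⁻¹ • x) atTop (𝓝 0) := by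
        simpa using (tendsto_one_div_add_atTop_nhds_zero_nat (𝕜 := ℝ)).smul_const x
      have h2 := (χ.continuous.tendsto 0).comp h1
      rwa [χ.one_of_mem_closedBall (by simp [χ.rIn_pos.le])] at h2
    · intro n x _
      rw [abs_mul, mul_comm]
      refine mul_le_mul_of_nonneg_right ((hdθ n x).trans ?_) (abs_nonneg _)
      exact mul_le_of_le_one_right (by positivity) (inv_le_one_of_one_le₀ (by simp))
    · intro x _
      refine squeeze_zero_norm (a := fun n : ℕ => |w x| * (C * ‖v‖ * ((n : ℝ) + 1)⁻¹)) ?_ ?_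
      · intro n
        rw [norm_mul]
        exact mul_le_mul_of_nonneg_left (hdθ n x) (norm_nonneg _)
      · simpa using ((tendsto_one_div_add_atTop_nhds_zero_nat (𝕜 := ℝ)).const_mul
          (C * ‖v‖)).const_mul |w x|
    · intro n
      exact H _ ((hθ n).mul hw) (hθc n).mul_right (fun x hx => by rw [hwZ x hx, mul_zero])
  have hsd : ∀ x, (∂_{v} s) x = fderiv ℝ s x v := fun x => lineDerivOp_apply_eq_fderiv v s x
  have hsL : MemLp s 2 volH := s.memLp_volH
  have hdsL : MemLp (fun x => (∂_{v} s) x) 2 volH := (∂_{v} s).memLp_volH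
  have hT : ∀ T : ℂ →L[ℝ] ℝ, ∫ x, φ x * ((T ((∂_{v} s) x) : ℝ) : ℂ) ∂volH =
      - ∫ x, g x * (T (s x) : ℂ) ∂volH := by
    intro T
    have hd : ∀ x, fderiv ℝ (fun y => T (s y)) x v = T ((∂_{v} s) x) := by
      intro x
      have := (T.hasFDerivAt.comp x s.differentiableAt.hasFDerivAt).fderiv
      change fderiv ℝ (T ∘ s) x v = _
      rw [this, hsd]
      rfl
    have := key (fun x => T (s x)) (T.contDiff.comp (s.smooth _)) (T.comp_memLp' hsL)
      (by simp only [hd]; exact T.comp_memLp' hdsL) (fun x hx => by rw [hs x hx, map_zero])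
    simpa only [hd] using this
  -- The real case is applied to real and imaginary parts, which inherit the vanishing on `Z`.
  have hdec : ∀ (f : L2C) (u : E3 → ℂ), MemLp u 2 volH → ∫ x, f x * u x ∂volH =
      ∫ x, f x * ((Complex.reCLM (u x) : ℝ) : ℂ) ∂volH +
        Complex.I * ∫ x, f x * ((Complex.imCLM (u x) : ℝ) : ℂ) ∂volH := by
    intro f u hu
    rw [← integral_const_mul, ← integral_add]
    · congr 1; ext x
      conv_lhs => rw [← Complex.re_add_im (u x)]
      simp only [Complex.reCLM_apply, Complex.imCLM_apply]
      ring
    · exact integrable_Lp_mul f (MemLp.complex_ofReal (Complex.reCLM.comp_memLp' hu))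
    · exact (integrable_Lp_mul f (MemLp.complex_ofReal
        (Complex.imCLM.comp_memLp' hu))).const_mul _
  rw [hdec φ _ hdsL, hdec g _ hsL, hT, hT]
  ring

theorem IsWeakPartial.green_schwartz {i : Fin 3} {φ g : L2C} (h : IsWeakPartial i φ g)
    (s : 𝓢(E3, ℂ)) (hs : ∀ x : E3, x 2 = 0 → s x = 0) :
    ∫ x, φ x * (∂_{e3 i} s) x ∂volH = - ∫ x, g x * s x ∂volH :=
  _root_.green_schwartz (Z := {x | x 2 = 0})
    (fun _ hw hc h0 => h.green_of_hasCompactSupport hw hc h0) s hs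

theorem HasZeroTrace.green_schwartz {φ g : L2C} (h : HasZeroTrace φ g) (s : 𝓢(E3, ℂ)) :
    ∫ x, φ x * (∂_{e3 2} s) x ∂volH = - ∫ x, g x * s x ∂volH := by
  refine _root_.green_schwartz (Z := ∅) (fun w hw hc _ => ?_) s (by simp)
  have := h ⟨w, hw, hc, Set.subset_univ _⟩
  simp only [TestFunction.lineDerivOp_apply_eq_fderiv] at this
  exact this

end WeakDerivatives

/-! ### The sine transform diagonalizes the Dirichlet operator -/

section Diagonalization

open SchwartzMap FourierTransform
open scoped ContDiff

/-- The symbol `1 + L² |2πk|²` of `1 - L²Δ`. -/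
def dirichletSymbol (L : ℝ) (k : E3) : ℝ := 1 + L ^ 2 * (2 * Real.pi) ^ 2 * ‖k‖ ^ 2

theorem one_le_dirichletSymbol (L : ℝ) (k : E3) : 1 ≤ dirichletSymbol L k := by
  unfold dirichletSymbol
  have : 0 ≤ L ^ 2 * (2 * Real.pi) ^ 2 * ‖k‖ ^ 2 := by positivity
  linarith

theorem dirichletSymbol_pos (L : ℝ) (k : E3) : 0 < dirichletSymbol L k :=
  one_pos.trans_le (one_le_dirichletSymbol L k)

@[simp]
theorem dirichletSymbol_reflZ (L : ℝ) (k : E3) : dirichletSymbol L (reflZ k) = dirichletSymbol L k := by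
  simp [dirichletSymbol]

@[fun_prop]
theorem continuous_dirichletSymbol (L : ℝ) : Continuous (dirichletSymbol L) := by
  unfold dirichletSymbol; fun_prop

theorem inner_e3 (k : E3) (i : Fin 3) : inner ℝ k (e3 i) = k i := by
  simp [e3, EuclideanSpace.inner_single_right]

theorem dirichletSymbol_eq_sum (L : ℝ) (k : E3) :
    dirichletSymbol L k = 1 + L ^ 2 * (2 * Real.pi) ^ 2 * ∑ i, k i ^ 2 := by
  rw [dirichletSymbol, EuclideanSpace.norm_sq_eq]
  simp

theorem hasTemperateGrowth_inner_e3 (i : Fin 3) :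
    (fun k : E3 => inner ℝ k (e3 i)).HasTemperateGrowth := by fun_prop

theorem fourier_smul_coord (s : 𝓢(E3, ℂ)) (i : Fin 3) :
    ∂_{e3 i} (𝓕 s) = 𝓕 (-(2 * Real.pi * Complex.I) • smulLeftCLM ℂ (inner ℝ · (e3 i)) s) :=
  SchwartzMap.lineDerivOp_fourier_eq s (e3 i)

theorem fourierInv_lineDeriv_e3 (s : 𝓢(E3, ℂ)) (i : Fin 3) (k : E3) :
    𝓕⁻ (∂_{e3 i} s) k = -(2 * Real.pi * Complex.I * k i) * 𝓕⁻ s k := by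
  rw [SchwartzMap.fourierInv_lineDerivOp_eq]
  rw [smul_apply, smulLeftCLM_apply_apply (hasTemperateGrowth_inner_e3 i), inner_e3,
    smul_eq_mul, Complex.real_smul]
  ring

/-- `s - L² ∑ ∂ᵢ∂ᵢ s`. -/
def SchwartzMap.helmholtz (L : ℝ) (s : 𝓢(E3, ℂ)) : 𝓢(E3, ℂ) :=
  s - ((L ^ 2 : ℝ) : ℂ) • ∑ i, ∂_{e3 i} (∂_{e3 i} s)

/-- Multiplication by the symbol becomes 1 - L²Δ on the other side of the Fourier transform. This
lets the symbol be moved onto a Schwartz function when identifying a Fourier transform by duality.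
-/
theorem exists_helmholtz_fourier (L : ℝ) (s : 𝓢(E3, ℂ)) : ∃ t : 𝓢(E3, ℂ),
    (∀ k, t k = (dirichletSymbol L k : ℂ) * s k) ∧ 𝓕 t = (𝓕 s).helmholtz L := by
  let m : Fin 3 → 𝓢(E3, ℂ) → 𝓢(E3, ℂ) := fun i s =>
    -(2 * Real.pi * Complex.I) • smulLeftCLM ℂ (inner ℝ · (e3 i)) s
  have hm : ∀ i s k, m i s k = -(2 * Real.pi * Complex.I * k i) * s k := by
    intro i s k
    simp only [m]
    rw [smul_apply, smulLeftCLM_apply_apply (hasTemperateGrowth_inner_e3 i), inner_e3,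
      smul_eq_mul, Complex.real_smul]
    ring
  refine ⟨s - ((L ^ 2 : ℝ) : ℂ) • ∑ i, m i (m i s), fun k => ?_, ?_⟩
  · rw [dirichletSymbol_eq_sum]
    simp only [sub_apply, smul_apply, add_apply, Fin.sum_univ_three, hm]
    push_cast
    simp only [smul_eq_mul]
    linear_combination (-(L : ℂ) ^ 2 * 4 * Real.pi ^ 2 * (k 0 ^ 2 + k 1 ^ 2 + k 2 ^ 2) * s k) *
      Complex.I_sq
  · have h : ∀ i s, 𝓕 (m i s) = ∂_{e3 i} (𝓕 s) := fun i s => (fourier_smul_coord s i).symm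
    rw [SchwartzMap.helmholtz]
    simp only [← h]
    change fourierTransformCLM ℂ _ = fourierTransformCLM ℂ _ - _ • ∑ i, fourierTransformCLM ℂ _
    simp only [map_sub, map_smul, map_sum]

theorem reflZ_e3 (i : Fin 3) : reflZ (e3 i) = if i = 2 then - e3 i else e3 i := by
  ext j
  by_cases hi : i = 2 <;> by_cases hj : j = 2 <;> simp_all [e3]

theorem lineDeriv_compIsometry_reflZ (s : 𝓢(E3, ℂ)) (i : Fin 3) :
    ∂_{e3 i} (SchwartzMap.compIsometry reflZ s) =
      if i = 2 then - SchwartzMap.compIsometry reflZ (∂_{e3 i} s)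
      else SchwartzMap.compIsometry reflZ (∂_{e3 i} s) := by
  have h : ∂_{e3 i} (SchwartzMap.compIsometry reflZ s) =
      SchwartzMap.compIsometry reflZ (∂_{reflZ (e3 i)} s) :=
    lineDerivOp_compCLMOfContinuousLinearEquiv (𝕜 := ℂ) (e3 i) (reflZ : E3 ≃L[ℝ] E3) s
  rw [h, reflZ_e3]
  split_ifs
  · rw [LineDeriv.lineDerivOp_left_neg, map_neg]
  · rfl

theorem reflZ_eq_self {x : E3} (hx : x 2 = 0) : reflZ x = x := by
  ext i
  by_cases hi : i = 2 <;> simp_all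

/-- The odd extension of a function in the domain has no singular part on the plane: (1 - L²Δ) acts
on it weakly and gives the odd extension of f. This is checked against Schwartz functions, where
oddness replaces w by w - w∘R (R the reflection), which vanishes on the plane. -/
theorem DirichletOp.fourier_oddExt {L : ℝ} {φ f : L2C} (h : DirichletOp L φ f) :
    (𝓕 (oddExt f) : L2F) =ᵐ[volume]
      fun k => (dirichletSymbol L k : ℂ) * (𝓕 (oddExt φ) : L2F) k := by
  obtain ⟨g, hh, hg, hgh, htr, hf⟩ := h
  have green : ∀ w : 𝓢(E3, ℂ), ∫ x, oddExt f x * w x = ∫ x, oddExt φ x * w.helmholtz L x := by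
    intro w
    set wo := w - SchwartzMap.compIsometry reflZ w with hwo
    have hvan : ∀ (v : 𝓢(E3, ℂ)) (x : E3), x 2 = 0 →
        (v - SchwartzMap.compIsometry reflZ v) x = 0 := by
      intro v x hx
      simp [reflZ_eq_self hx]
    have hder : ∀ i, i ≠ 2 → ∂_{e3 i} wo = ∂_{e3 i} w - SchwartzMap.compIsometry reflZ (∂_{e3 i} w) := by
      intro i hi
      rw [hwo, sub_eq_add_neg, LineDeriv.lineDerivOp_add, LineDeriv.lineDerivOp_neg, lineDeriv_compIsometry_reflZ, if_neg hi,
        ← sub_eq_add_neg]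
    have hder2 : ∀ i, ∂_{e3 i} (∂_{e3 i} wo) = ∂_{e3 i} (∂_{e3 i} w) -
        SchwartzMap.compIsometry reflZ (∂_{e3 i} (∂_{e3 i} w)) := by
      intro i
      rw [hwo, sub_eq_add_neg, LineDeriv.lineDerivOp_add, LineDeriv.lineDerivOp_neg, lineDeriv_compIsometry_reflZ]
      by_cases hi : i = 2
      · rw [if_pos hi, neg_neg, LineDeriv.lineDerivOp_add, lineDeriv_compIsometry_reflZ, if_pos hi, ← sub_eq_add_neg]
      · rw [if_neg hi, LineDeriv.lineDerivOp_add, LineDeriv.lineDerivOp_neg, lineDeriv_compIsometry_reflZ, if_neg hi,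
          ← sub_eq_add_neg]
    -- Two integrations by parts. The one against `wo` needs no boundary condition on g, as `wo`
    -- vanishes on the plane. In the other, a tangential derivative of `wo` still vanishes there,
    -- but the normal derivative need not, and this is where the zero trace of φ enters.
    have hsecond : ∀ i, ∫ x, hh i i x * wo x ∂volH = ∫ x, φ x * (∂_{e3 i} (∂_{e3 i} wo)) x ∂volH := by
      intro i
      have h1 := (hgh i i).green_schwartz wo (hvan w)
      have h2 : ∫ x, φ x * (∂_{e3 i} (∂_{e3 i} wo)) x ∂volH =
          - ∫ x, g i x * (∂_{e3 i} wo) x ∂volH := by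
        by_cases hi : i = 2
        · subst hi
          exact htr.green_schwartz _
        · refine (hg i).green_schwartz _ ?_
          rw [hder i hi]
          exact hvan _
      rw [h2, h1, neg_neg]
    have hfae : f =ᵐ[volH] fun x => φ x - ((L ^ 2 : ℝ) : ℂ) * ∑ i, hh i i x := by
      rw [hf]
      filter_upwards [Lp.coeFn_sub φ (((L ^ 2 : ℝ) : ℂ) • ∑ i, hh i i),
        Lp.coeFn_smul ((L ^ 2 : ℝ) : ℂ) (∑ i, hh i i),
        Lp.coeFn_finsetSum Finset.univ (fun i => hh i i)] with x h1 h2 h3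
      rw [h1, Pi.sub_apply, h2, Pi.smul_apply, h3, smul_eq_mul]
      simp
    have hi : ∀ (u : L2C) (v : 𝓢(E3, ℂ)), Integrable (fun x => u x * v x) volH := fun u v =>
      integrable_Lp_mul u v.memLp_volH
    have e1 : ∀ (u : L2C) (v : 𝓢(E3, ℂ)), ∫ x, oddExt u x * v x =
        ∫ x, u x * (v - SchwartzMap.compIsometry reflZ v) x ∂volH := fun u v =>
      integral_oddExt_mul u (v.memLp 2)
    rw [e1, e1]
    have e2 : w.helmholtz L - SchwartzMap.compIsometry reflZ (w.helmholtz L) = wo.helmholtz L := by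
      simp only [SchwartzMap.helmholtz, hder2, map_sub, map_smul, map_sum, Finset.sum_sub_distrib,
        smul_sub]
      rw [hwo]
      abel
    rw [e2, ← hwo]
    calc ∫ x, f x * wo x ∂volH
        = ∫ x, (φ x * wo x - ((L ^ 2 : ℝ) : ℂ) * ∑ i, hh i i x * wo x) ∂volH := by
          apply integral_congr_ae
          filter_upwards [hfae] with x hx
          rw [hx, sub_mul, mul_assoc, Finset.sum_mul]
      _ = ∫ x, φ x * wo x ∂volH - ((L ^ 2 : ℝ) : ℂ) * ∑ i, ∫ x, hh i i x * wo x ∂volH := by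
          rw [integral_sub (hi _ _) ((integrable_finsetSum _ fun i _ => hi _ _).const_mul _),
            integral_const_mul, integral_finsetSum _ fun i _ => hi _ _]
      _ = ∫ x, φ x * wo x ∂volH - ((L ^ 2 : ℝ) : ℂ) *
            ∑ i, ∫ x, φ x * (∂_{e3 i} (∂_{e3 i} wo)) x ∂volH := by simp only [hsecond]
      _ = ∫ x, (φ x * wo x - ((L ^ 2 : ℝ) : ℂ) *
            ∑ i, φ x * (∂_{e3 i} (∂_{e3 i} wo)) x) ∂volH := by
          rw [integral_sub (hi _ _) ((integrable_finsetSum _ fun i _ => hi _ _).const_mul _),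
            integral_const_mul, integral_finsetSum _ fun i _ => hi _ _]
      _ = _ := by
          congr 1; ext x
          simp only [SchwartzMap.helmholtz, sub_apply, smul_apply, sum_apply, smul_eq_mul,
            Finset.mul_sum]
          rw [mul_sub, Finset.mul_sum]
          congr 1
          exact Finset.sum_congr rfl fun i _ => by ring
  have hloc : LocallyIntegrable
      (fun k => (dirichletSymbol L k : ℂ) * (𝓕 (oddExt φ) : L2F) k) := by
    have := MemLp.locallyIntegrable_two (Lp.memLp (𝓕 (oddExt φ) : L2F))
    rw [locallyIntegrable_iff] at this ⊢
    exact fun K hK => (this K hK).continuousOn_mul (by fun_prop) hK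
  refine Lp.fourier_ae_eq hloc fun s => ?_
  obtain ⟨t, ht, hts⟩ := exists_helmholtz_fourier L s
  rw [green, ← hts, ← Lp.integral_fourier_mul]
  congr 1; ext k
  rw [ht]; ring

theorem integral_eq_integral_add_reflZ {F : E3 → ℂ} (hF : Integrable F) :
    ∫ x, F x = ∫ x, (F x + F (reflZ x)) ∂volH := by
  have h1 : ∫ x in (halfSpace : Set E3)ᶜ, F x = ∫ x in (halfSpace : Set E3), F (reflZ x) := by
    have h2 := reflZ.measurePreserving.setIntegral_preimage_emb
      reflZ.toHomeomorph.measurableEmbedding (fun x => F (reflZ x)) (halfSpace : Set E3)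
    rw [← h2]
    simp only [reflZ_reflZ]
    apply setIntegral_congr_set
    filter_upwards [ae_coord_two_ne_zero] with x hx
    apply propext
    change ¬ (0 < x 2) ↔ 0 < reflZ x 2
    simp only [reflZ_apply, if_true]
    constructor
    · intro h; have := lt_of_le_of_ne (not_lt.1 h) hx; linarith
    · intro h; linarith
  rw [← integral_add_compl measurableSet_halfSpace hF, h1, volH]
  exact (integral_add hF.integrableOn
    (reflZ.measurePreserving.integrable_comp_of_integrable hF).integrableOn).symm

/-- Parseval's formula: on the whole space a weak derivative is multiplication by 2πi k_j on the
Fourier side. -/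
theorem integral_mul_lineDeriv_of_fourier {h G : L2F} {j : Fin 3}
    (hG : (𝓕 G : L2F) =ᵐ[volume] fun k => 2 * Real.pi * Complex.I * k j * (𝓕 h : L2F) k)
    (s : 𝓢(E3, ℂ)) : ∫ x, h x * (∂_{e3 j} s) x = - ∫ x, G x * s x := by
  have h1 : ∀ (u : L2F) (t : 𝓢(E3, ℂ)), ∫ x, u x * t x = ∫ k, (𝓕 u : L2F) k * 𝓕⁻ t k := by
    intro u t
    rw [← Lp.integral_fourierInv_mul, FourierTransform.fourierInv_fourier_eq]
  rw [h1, h1 G, ← integral_neg]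
  apply integral_congr_ae
  filter_upwards [hG] with k hk
  rw [hk, fourierInv_lineDeriv_e3]
  ring

theorem exists_fourier_eq_mul {h f : L2F} {p q : E3 → ℂ} {C : ℝ} (hp : Continuous p)
    (hf : (𝓕 f : L2F) =ᵐ[volume] fun k => q k * (𝓕 h : L2F) k) (hpq : ∀ k, ‖p k‖ ≤ C * ‖q k‖) :
    ∃ G : L2F, (𝓕 G : L2F) =ᵐ[volume] fun k => p k * (𝓕 h : L2F) k := by
  have hm : MemLp (fun k => p k * (𝓕 h : L2F) k) 2 := by
    refine (Lp.memLp (𝓕 f : L2F)).of_le_mul (c := C)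
      (hp.aestronglyMeasurable.mul (Lp.memLp (𝓕 h : L2F)).1) ?_
    filter_upwards [hf] with k hk
    rw [hk, norm_mul, norm_mul, ← mul_assoc]
    exact mul_le_mul_of_nonneg_right (hpq k) (norm_nonneg _)
  refine ⟨𝓕⁻ (hm.toLp _), ?_⟩
  rw [FourierTransform.fourier_fourierInv_eq]
  exact hm.coeFn_toLp

/-- A test function as a Schwartz function. -/
def TestFunction.toSchwartz {Ω : TopologicalSpace.Opens E3} (η : 𝓓(Ω, ℝ)) : 𝓢(E3, ℂ) :=
  schwartzOfReal η η.contDiff η.hasCompactSupport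

@[simp]
theorem TestFunction.toSchwartz_apply {Ω : TopologicalSpace.Opens E3} (η : 𝓓(Ω, ℝ)) (x : E3) :
    η.toSchwartz x = (η x : ℂ) := rfl

theorem TestFunction.toSchwartz_lineDeriv {Ω : TopologicalSpace.Opens E3} (η : 𝓓(Ω, ℝ)) (v : E3) :
    (∂_{v} η).toSchwartz = ∂_{v} η.toSchwartz := by
  ext x
  rw [TestFunction.toSchwartz_apply, TestFunction.lineDerivOp_apply_eq_fderiv,
    SchwartzMap.lineDerivOp_apply_eq_fderiv]
  have := (Complex.ofRealCLM.hasFDerivAt.comp x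
    (η.contDiff.differentiable (by simp) x).hasFDerivAt).fderiv
  change _ = fderiv ℝ (Complex.ofRealCLM ∘ η) x v
  rw [this]
  rfl

theorem TestFunction.eq_zero_of_notMem {Ω : TopologicalSpace.Opens E3} (η : 𝓓(Ω, ℝ)) {x : E3}
    (hx : x ∉ Ω) : η x = 0 :=
  image_eq_zero_of_notMem_tsupport fun h => hx (η.tsupport_subset h)

theorem integral_resH_mul_testFunction (h : L2F) (η : 𝓓(halfSpace, ℝ)) :
    ∫ x, resH h x * (η x : ℂ) ∂volH = ∫ x, h x * η.toSchwartz x := by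
  rw [← setIntegral_eq_integral_of_forall_compl_eq_zero (s := (halfSpace : Set E3)) (μ := volume)]
  · apply integral_congr_ae
    filter_upwards [coeFn_resH h] with x hx
    rw [hx, TestFunction.toSchwartz_apply]
  · intro x hx
    rw [TestFunction.toSchwartz_apply, η.eq_zero_of_notMem hx]
    simp

theorem isWeakPartial_resH {h G : L2F} {j : Fin 3}
    (hG : (𝓕 G : L2F) =ᵐ[volume] fun k => 2 * Real.pi * Complex.I * k j * (𝓕 h : L2F) k) :
    IsWeakPartial j (resH h) (resH G) := by
  intro η
  rw [integral_resH_mul_testFunction, integral_resH_mul_testFunction,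
    TestFunction.toSchwartz_lineDeriv, integral_mul_lineDeriv_of_fourier hG]

/-- If the odd extension has a square-integrable weak normal derivative on all of space, it cannot
jump across the plane, so its trace is 0. The proof splits the test function into its even and odd
parts under the reflection. -/
theorem hasZeroTrace_resH {φ : L2C} {G : L2F} (hG : (𝓕 G : L2F) =ᵐ[volume]
      fun k => 2 * Real.pi * Complex.I * k 2 * (𝓕 (oddExt φ) : L2F) k) :
    HasZeroTrace φ (resH G) := by
  intro η
  -- The normal derivative of an odd function is even: k_z is odd and so is the Fourier transform it
  -- multiplies.
  have heven : Lp.compIsometry reflZ G = G := by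
    apply (Lp.fourierTransformₗᵢ E3 ℂ).injective
    change 𝓕 (Lp.compIsometry reflZ G) = 𝓕 G
    rw [Lp.fourier_compIsometry]
    apply Lp.ext
    have hodd : ∀ᵐ k, (𝓕 (oddExt φ) : L2F) (reflZ k) = -(𝓕 (oddExt φ) : L2F) k := by
      filter_upwards [Lp.coeFn_compIsometry reflZ (𝓕 (oddExt φ)),
        Lp.coeFn_neg (𝓕 (oddExt φ) : L2F)] with k h1 h2
      rw [← h1, compIsometry_fourier_oddExt, h2, Pi.neg_apply]
    filter_upwards [Lp.coeFn_compIsometry reflZ (𝓕 G), hG,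
      reflZ.measurePreserving.quasiMeasurePreserving.ae hG, hodd] with k h1 h2 h3 h4
    rw [h1, h3, h2, h4]
    simp
  have hweak : IsWeakPartial 2 φ (resH G) := by
    have := isWeakPartial_resH hG
    rwa [resH_oddExt] at this
  set s := η.toSchwartz with hs
  set σs := SchwartzMap.compIsometry reflZ s with hσs
  -- Even part: both integrands are even, so the half-space identity is the whole-space integration
  -- by parts folded onto the half-space.
  have hev : ∫ x, φ x * (∂_{e3 2} s + ∂_{e3 2} σs) x ∂volH =
      - ∫ x, resH G x * (s + σs) x ∂volH := by
    have h1 := integral_oddExt_mul φ ((∂_{e3 2} s).memLp 2)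
    have h2 := integral_eq_integral_add_reflZ
      (MemLp.integrable_mul (Lp.memLp G) (s.memLp 2 volume))
    simp only [Pi.mul_apply] at h2
    rw [integral_mul_lineDeriv_of_fourier hG, h2] at h1
    have h3 : ∫ x, resH G x * (s + σs) x ∂volH =
        ∫ x, (G x * s x + G (reflZ x) * s (reflZ x)) ∂volH := by
      apply integral_congr_ae
      have h4 : ∀ᵐ x ∂volH, Lp.compIsometry reflZ G x = G (reflZ x) :=
        ae_restrict_of_ae (Lp.coeFn_compIsometry reflZ G)
      filter_upwards [coeFn_resH G, h4] with x h5 h6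
      rw [← h6, heven, h5]
      simp [hσs, mul_add]
    rw [h3, h1]
    congr 1; ext x
    rw [hσs, lineDeriv_compIsometry_reflZ, if_pos rfl]
    simp [sub_eq_add_neg]
  -- Odd part: it vanishes on the plane, so the weak derivative on the half-space suffices.
  have hod : ∫ x, φ x * (∂_{e3 2} s - ∂_{e3 2} σs) x ∂volH =
      - ∫ x, resH G x * (s - σs) x ∂volH := by
    have := hweak.green_schwartz (s - σs) (fun x hx => by simp [hσs, reflZ_eq_self hx])
    rwa [sub_eq_add_neg s, LineDeriv.lineDerivOp_add, LineDeriv.lineDerivOp_neg, ← sub_eq_add_neg,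
      ← sub_eq_add_neg] at this
  have hi : ∀ (u : L2C) (v : 𝓢(E3, ℂ)), Integrable (fun x => u x * v x) volH := fun u v =>
    integrable_Lp_mul u v.memLp_volH
  simp only [add_apply, sub_apply, mul_add, mul_sub] at hev hod
  rw [integral_add (hi _ _) (hi _ _), integral_add (hi _ _) (hi _ _)] at hev
  rw [integral_sub (hi _ _) (hi _ _), integral_sub (hi _ _) (hi _ _)] at hod
  simp only [← TestFunction.toSchwartz_apply, TestFunction.toSchwartz_lineDeriv]
  linear_combination (hev + hod) / 2

/-- Elliptic regularity on the Fourier side: σ dominates 2π|k_j| and (2π)²|k_i k_j| up to constants,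
so all first and second derivatives of the odd extension are in L². Restricting them gives the
required weak derivatives. -/
theorem dirichletOp_of_fourier_oddExt {L : ℝ} (hL : 0 < L) {φ f : L2C}
    (h : (𝓕 (oddExt f) : L2F) =ᵐ[volume]
      fun k => (dirichletSymbol L k : ℂ) * (𝓕 (oddExt φ) : L2F) k) : DirichletOp L φ f := by
  have hnorm : ∀ k, ‖(dirichletSymbol L k : ℂ)‖ = 1 + (L * (2 * Real.pi * ‖k‖)) ^ 2 := by
    intro k
    rw [Complex.norm_real, Real.norm_eq_abs, abs_of_pos (dirichletSymbol_pos L k), dirichletSymbol]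
    ring
  have hcoord : ∀ (k : E3) (j : Fin 3), ‖2 * (Real.pi : ℂ) * Complex.I * k j‖ ≤
      2 * Real.pi * ‖k‖ := by
    intro k j
    simp only [norm_mul, Complex.norm_I, Complex.norm_real, Complex.norm_ofNat, mul_one,
      Real.norm_eq_abs, abs_of_pos Real.pi_pos]
    gcongr
    exact PiLp.norm_apply_le k j
  have h1 : ∀ j : Fin 3, ∃ G : L2F, (𝓕 G : L2F) =ᵐ[volume]
      fun k => 2 * Real.pi * Complex.I * k j * (𝓕 (oddExt φ) : L2F) k := by
    intro j
    -- With r = 2πL|k|, the bound is r ≤ 1 + r².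
    refine exists_fourier_eq_mul (C := L⁻¹) (by fun_prop) h fun k => ?_
    rw [hnorm, le_inv_mul_iff₀ hL]
    have := mul_le_mul_of_nonneg_left (hcoord k j) hL.le
    nlinarith [sq_nonneg (L * (2 * Real.pi * ‖k‖) - 1)]
  have h2 : ∀ i j : Fin 3, ∃ G : L2F, (𝓕 G : L2F) =ᵐ[volume]
      fun k => 2 * Real.pi * Complex.I * k j * (2 * Real.pi * Complex.I * k i) *
        (𝓕 (oddExt φ) : L2F) k := by
    intro i j
    refine exists_fourier_eq_mul (C := (L ^ 2)⁻¹) (by fun_prop) h fun k => ?_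
    rw [hnorm, le_inv_mul_iff₀ (by positivity), norm_mul]
    have := mul_le_mul (hcoord k j) (hcoord k i) (norm_nonneg _) (by positivity)
    have := mul_le_mul_of_nonneg_left this (sq_nonneg L)
    nlinarith
  choose G hG using h1
  choose M hM using h2
  refine ⟨fun i => resH (G i), fun i j => resH (M i j), fun i => ?_, fun i j => ?_,
    hasZeroTrace_resH (hG 2), ?_⟩
  · have := isWeakPartial_resH (hG i)
    rwa [resH_oddExt] at this
  · apply isWeakPartial_resH
    filter_upwards [hM i j, hG i] with k h3 h4
    rw [h3, h4]; ring
  · have h5 : oddExt f = oddExt φ - ((L ^ 2 : ℝ) : ℂ) • ∑ i, M i i := by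
      apply (Lp.fourierTransformₗᵢ E3 ℂ).injective
      rw [map_sub, map_smul, map_sum]
      apply Lp.ext
      refine EventuallyEq.trans h ?_
      filter_upwards [Lp.coeFn_sub (Lp.fourierTransformₗᵢ E3 ℂ (oddExt φ))
          (((L ^ 2 : ℝ) : ℂ) • ∑ i, Lp.fourierTransformₗᵢ E3 ℂ (M i i)),
        Lp.coeFn_smul ((L ^ 2 : ℝ) : ℂ) (∑ i, Lp.fourierTransformₗᵢ E3 ℂ (M i i)),
        Lp.coeFn_finsetSum Finset.univ (fun i => Lp.fourierTransformₗᵢ E3 ℂ (M i i)),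
        hM 0 0, hM 1 1, hM 2 2] with k e1 e2 e3 m0 m1 m2
      rw [e1, Pi.sub_apply, e2, Pi.smul_apply, e3, Finset.sum_apply, Fin.sum_univ_three]
      change _ = (𝓕 (oddExt φ) : L2F) k - _ • ((𝓕 (M 0 0) : L2F) k + (𝓕 (M 1 1) : L2F) k +
        (𝓕 (M 2 2) : L2F) k)
      rw [m0, m1, m2, dirichletSymbol_eq_sum, Fin.sum_univ_three, smul_eq_mul]
      push_cast
      linear_combination ((L : ℂ) ^ 2 * 4 * Real.pi ^ 2 * (k 0 ^ 2 + k 1 ^ 2 + k 2 ^ 2) *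
        (𝓕 (oddExt φ) : L2F) k) * Complex.I_sq
    rw [← resH_oddExt f, h5, map_sub, map_smul, map_sum, resH_oddExt]

/-- Both Fourier transforms are odd, so an identity with an even multiplier on the half-space of
frequencies extends to all frequencies. -/
theorem sineTransform_eq_mul_iff {q : E3 → ℂ} (hq : ∀ k, q (reflZ k) = q k) (φ f : L2C) :
    (∀ᵐ k ∂volH, sineTransform f k = q k * sineTransform φ k) ↔
      (𝓕 (oddExt f) : L2F) =ᵐ[volume] fun k => q k * (𝓕 (oddExt φ) : L2F) k := by
  constructor
  · intro h
    have h1 : ∀ᵐ k, k ∈ (halfSpace : Set E3) → sineTransform f k = q k * sineTransform φ k :=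
      (ae_restrict_iff' measurableSet_halfSpace).1 h
    have h2 : ∀ᵐ k, (halfSpace : Set E3).indicator (sineTransform f) k =
        q k * (halfSpace : Set E3).indicator (sineTransform φ) k := by
      filter_upwards [h1] with k hk
      by_cases hm : k ∈ (halfSpace : Set E3)
      · simp only [Set.indicator_of_mem hm, hk hm]
      · simp only [Set.indicator_of_notMem hm, mul_zero]
    rw [← oddExt_sineTransform, ← oddExt_sineTransform]
    filter_upwards [coeFn_oddExt (sineTransform f), coeFn_oddExt (sineTransform φ), h2,
      reflZ.measurePreserving.quasiMeasurePreserving.ae h2] with k e1 e2 e3 e4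
    rw [e1, e2, e3, e4, hq]
    ring
  · intro h
    filter_upwards [coeFn_resH (𝓕 (oddExt f)), coeFn_resH (𝓕 (oddExt φ)),
      (ae_restrict_of_ae h : ∀ᵐ k ∂volH, _)] with k e1 e2 e3
    rw [sineTransform_apply, sineTransform_apply, e1, e2, e3]

theorem diagonalizes_sineTransform {L : ℝ} (hL : 0 < L) :
    Diagonalizes (DirichletOp L) volH (dirichletSymbol L) sineTransform := by
  intro φ f
  rw [sineTransform_eq_mul_iff (q := fun k => (dirichletSymbol L k : ℂ)) (by simp)]
  exact ⟨fun h => h.fourier_oddExt, dirichletOp_of_fourier_oddExt hL⟩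

theorem fracPow_dirichletOp {L : ℝ} (hL : 0 < L) {α : ℝ} {φ f : L2C}
    (h : (𝓕 (oddExt f) : L2F) =ᵐ[volume]
      fun k => ((dirichletSymbol L k ^ α : ℝ) : ℂ) * (𝓕 (oddExt φ) : L2F) k) :
    FracPow (DirichletOp L) α φ f :=
  ⟨E3, inferInstance, volH, dirichletSymbol L, sineTransform,
    inferInstanceAs (SigmaFinite (volume.restrict (halfSpace : Set E3))),
    (continuous_dirichletSymbol L).measurable, diagonalizes_sineTransform hL,
    (sineTransform_eq_mul_iff (q := fun k => ((dirichletSymbol L k ^ α : ℝ) : ℂ)) (by simp) φ f).2 h⟩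

end Diagonalization

/-! ### The gradient of the kernel of A^(-17/12) as a continuous L²-valued map -/

section GradientKernel

open SchwartzMap FourierTransform

theorem L2.norm_sq_eq_integral {α 𝕜 E : Type*} [MeasurableSpace α] {m : Measure α} [RCLike 𝕜]
    [NormedAddCommGroup E] [InnerProductSpace 𝕜 E] (f : Lp E 2 m) :
    ‖f‖ ^ 2 = ∫ x, ‖f x‖ ^ 2 ∂m := by
  have h := inner_self_eq_norm_sq_to_K (𝕜 := 𝕜) f
  rw [L2.inner_def] at h
  simp only [inner_self_eq_norm_sq_to_K, ← RCLike.ofReal_pow] at h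
  rw [integral_ofReal] at h
  exact_mod_cast h.symm

/-- The symbol is at least c(1 + |k|²), so the integrand is bounded by a multiple of (1 + |k|²)^(1 -
17/6), which decays like |k|^(-11/3), and 11/3 > 3. This is why the velocity has finite variance at
each point. -/
theorem integrable_coord_sq_mul_dirichletSymbol {L : ℝ} (hL : 0 < L) (j : Fin 3) :
    Integrable fun k : E3 => k j ^ 2 * dirichletSymbol L k ^ (-(17 / 6) : ℝ) := by
  set c : ℝ := min 1 (L ^ 2 * (2 * Real.pi) ^ 2) with hc
  have hc0 : 0 < c := lt_min one_pos (by positivity)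
  have hint : Integrable fun k : E3 => (1 + ‖k‖ ^ 2) ^ (-(11 / 3) / 2 : ℝ) :=
    integrable_rpow_neg_one_add_norm_sq (by rw [finrank_euclideanSpace_fin]; norm_num)
  refine (hint.const_mul (c ^ (-(17 / 6) : ℝ))).mono'
    (Continuous.aestronglyMeasurable ?_) (Eventually.of_forall fun k => ?_)
  · refine Continuous.mul (by fun_prop) ((continuous_dirichletSymbol L).rpow_const fun k => ?_)
    exact Or.inl (dirichletSymbol_pos L k).ne'
  · have h1 : c * (1 + ‖k‖ ^ 2) ≤ dirichletSymbol L k := by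
      rw [dirichletSymbol, mul_add]
      have := min_le_left 1 (L ^ 2 * (2 * Real.pi) ^ 2)
      have := mul_le_mul_of_nonneg_right (min_le_right 1 (L ^ 2 * (2 * Real.pi) ^ 2))
        (sq_nonneg ‖k‖)
      linarith
    have h2 : dirichletSymbol L k ^ (-(17 / 6) : ℝ) ≤
        c ^ (-(17 / 6) : ℝ) * (1 + ‖k‖ ^ 2) ^ (-(17 / 6) : ℝ) := by
      rw [← Real.mul_rpow hc0.le (by positivity)]
      exact Real.rpow_le_rpow_of_nonpos (by positivity) h1 (by norm_num)
    have h3 : k j ^ 2 ≤ 1 + ‖k‖ ^ 2 := by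
      have : k j ^ 2 ≤ ‖k‖ ^ 2 := by
        rw [← sq_abs]
        exact pow_le_pow_left₀ (abs_nonneg _) (PiLp.norm_apply_le k j) 2
      linarith
    have h4 : (1 + ‖k‖ ^ 2) ^ (-(11 / 3) / 2 : ℝ) =
        (1 + ‖k‖ ^ 2) * (1 + ‖k‖ ^ 2) ^ (-(17 / 6) : ℝ) := by
      rw [← Real.rpow_one_add' (by positivity) (by norm_num)]
      norm_num
    have h5 := Real.rpow_nonneg (dirichletSymbol_pos L k).le (-(17 / 6) : ℝ)
    rw [Real.norm_of_nonneg (by positivity), h4]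
    calc k j ^ 2 * dirichletSymbol L k ^ (-(17 / 6) : ℝ)
        ≤ (1 + ‖k‖ ^ 2) * (c ^ (-(17 / 6) : ℝ) * (1 + ‖k‖ ^ 2) ^ (-(17 / 6) : ℝ)) := by
          gcongr
      _ = _ := by ring

/-- The Fourier transform of `y ↦ ∂ⱼ G(x - y)`, where `G` is the kernel of the operator
`(1 - L²Δ) ^ (-17/12)` on the whole space. -/
def gradSymbol (L : ℝ) (j : Fin 3) (x k : E3) : ℂ :=
  -(2 * Real.pi * Complex.I * k j) * Complex.exp ((-2 * Real.pi * inner ℝ x k : ℝ) * Complex.I) *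
    ((dirichletSymbol L k ^ (-(17 / 12) : ℝ) : ℝ) : ℂ)

theorem continuous_dirichletSymbol_rpow (L a : ℝ) : Continuous fun k => dirichletSymbol L k ^ a :=
  (continuous_dirichletSymbol L).rpow_const fun k => Or.inl (dirichletSymbol_pos L k).ne'

theorem continuous_gradSymbol_right (L : ℝ) (j : Fin 3) (x : E3) :
    Continuous (gradSymbol L j x) := by
  have := continuous_dirichletSymbol_rpow L (-(17 / 12))
  unfold gradSymbol
  fun_prop

theorem continuous_gradSymbol_left (L : ℝ) (j : Fin 3) (k : E3) :
    Continuous fun x => gradSymbol L j x k := by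
  unfold gradSymbol
  fun_prop

theorem norm_gradSymbol (L : ℝ) (j : Fin 3) (x k : E3) :
    ‖gradSymbol L j x k‖ = 2 * Real.pi * |k j| * dirichletSymbol L k ^ (-(17 / 12) : ℝ) := by
  rw [gradSymbol, norm_mul, norm_mul, Complex.norm_exp_ofReal_mul_I, Complex.norm_real,
    Real.norm_of_nonneg (Real.rpow_nonneg (dirichletSymbol_pos L k).le _)]
  simp [abs_of_pos Real.pi_pos]

theorem dirichletSymbol_rpow_sq (L : ℝ) (k : E3) :
    (dirichletSymbol L k ^ (-(17 / 12) : ℝ)) ^ 2 = dirichletSymbol L k ^ (-(17 / 6) : ℝ) := by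
  rw [← Real.rpow_natCast, ← Real.rpow_mul (dirichletSymbol_pos L k).le]
  norm_num

theorem norm_gradSymbol_sq (L : ℝ) (j : Fin 3) (x k : E3) :
    ‖gradSymbol L j x k‖ ^ 2 =
      (2 * Real.pi) ^ 2 * (k j ^ 2 * dirichletSymbol L k ^ (-(17 / 6) : ℝ)) := by
  rw [norm_gradSymbol, ← dirichletSymbol_rpow_sq, mul_pow, mul_pow, sq_abs]
  ring

theorem memLp_gradSymbol {L : ℝ} (hL : 0 < L) (j : Fin 3) (x : E3) :
    MemLp (gradSymbol L j x) 2 := by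
  rw [← integrable_norm_rpow_iff (continuous_gradSymbol_right L j x).aestronglyMeasurable
    (by norm_num) (by norm_num)]
  simp only [ENNReal.toReal_ofNat, Real.rpow_ofNat, norm_gradSymbol_sq]
  exact (integrable_coord_sq_mul_dirichletSymbol hL j).const_mul _

/-- `gradSymbol` as a square-integrable function. -/
def gradSymbolLp {L : ℝ} (hL : 0 < L) (j : Fin 3) (x : E3) : L2F := (memLp_gradSymbol hL j x).toLp _

theorem coeFn_gradSymbolLp {L : ℝ} (hL : 0 < L) (j : Fin 3) (x : E3) :
    gradSymbolLp hL j x =ᵐ[volume] gradSymbol L j x :=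
  (memLp_gradSymbol hL j x).coeFn_toLp

theorem continuous_gradSymbolLp {L : ℝ} (hL : 0 < L) (j : Fin 3) :
    Continuous (gradSymbolLp hL j) := by
  rw [continuous_iff_continuousAt]
  intro x₀
  rw [ContinuousAt, tendsto_iff_norm_sub_tendsto_zero]
  have h1 : ∀ x, ‖gradSymbolLp hL j x - gradSymbolLp hL j x₀‖ =
      √(∫ k, ‖gradSymbol L j x k - gradSymbol L j x₀ k‖ ^ 2) := by
    intro x
    rw [eq_comm, Real.sqrt_eq_iff_eq_sq (integral_nonneg fun _ => by positivity) (norm_nonneg _),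
      L2.norm_sq_eq_integral (𝕜 := ℂ)]
    apply integral_congr_ae
    filter_upwards [Lp.coeFn_sub (gradSymbolLp hL j x) (gradSymbolLp hL j x₀),
      coeFn_gradSymbolLp hL j x, coeFn_gradSymbolLp hL j x₀] with k e1 e2 e3
    rw [e1, Pi.sub_apply, e2, e3]
  simp only [h1]
  rw [← Real.sqrt_zero]
  apply (Real.continuous_sqrt.tendsto 0).comp
  have h2 : ∫ k : E3, ‖gradSymbol L j x₀ k - gradSymbol L j x₀ k‖ ^ 2 = 0 := by simp
  rw [← h2]
  -- The point x enters the symbol only through a phase, so its modulus does not depend on x, and |a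
  -- - b|² ≤ 4|a|² gives an integrable bound uniform in x.
  apply tendsto_integral_filter_of_dominated_convergence
    (fun k : E3 => 4 * ((2 * Real.pi) ^ 2 * (k j ^ 2 * dirichletSymbol L k ^ (-(17 / 6) : ℝ))))
  · refine Eventually.of_forall fun x => Continuous.aestronglyMeasurable ?_
    have := continuous_gradSymbol_right L j x
    have := continuous_gradSymbol_right L j x₀
    fun_prop
  · refine Eventually.of_forall fun x => Eventually.of_forall fun k => ?_
    rw [Real.norm_of_nonneg (by positivity), ← norm_gradSymbol_sq L j x k]
    have h3 : ‖gradSymbol L j x₀ k‖ = ‖gradSymbol L j x k‖ := by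
      rw [norm_gradSymbol, norm_gradSymbol]
    have h4 := norm_sub_le (gradSymbol L j x k) (gradSymbol L j x₀ k)
    rw [h3] at h4
    calc _ ≤ (‖gradSymbol L j x k‖ + ‖gradSymbol L j x k‖) ^ 2 := by gcongr
      _ = _ := by ring
  · exact ((integrable_coord_sq_mul_dirichletSymbol hL j).const_mul _).const_mul _
  · refine Eventually.of_forall fun k => ?_
    have := continuous_gradSymbol_left L j k
    exact ((by fun_prop : Continuous fun x =>
      ‖gradSymbol L j x k - gradSymbol L j x₀ k‖ ^ 2).tendsto x₀)

/-- The antisymmetrization of `gradSymbolLp`. -/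
def oddGradSymbol {L : ℝ} (hL : 0 < L) (j : Fin 3) (x : E3) : L2F :=
  gradSymbolLp hL j x - Lp.compIsometry reflZ (gradSymbolLp hL j x)

theorem coeFn_oddGradSymbol {L : ℝ} (hL : 0 < L) (j : Fin 3) (x : E3) :
    oddGradSymbol hL j x =ᵐ[volume] fun k => gradSymbol L j x k - gradSymbol L j x (reflZ k) := by
  filter_upwards [Lp.coeFn_sub (gradSymbolLp hL j x) (Lp.compIsometry reflZ (gradSymbolLp hL j x)),
    coeFn_gradSymbolLp hL j x, Lp.coeFn_compIsometry reflZ (gradSymbolLp hL j x),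
    reflZ.measurePreserving.quasiMeasurePreserving.ae (coeFn_gradSymbolLp hL j x)] with k e1 e2 e3 e4
  rw [oddGradSymbol, e1, Pi.sub_apply, e2, e3, e4]

theorem compIsometry_sub_compIsometry (q : L2F) :
    Lp.compIsometry reflZ (q - Lp.compIsometry reflZ q) = -(q - Lp.compIsometry reflZ q) := by
  rw [map_sub, Lp.compIsometry_compIsometry _ reflZ_reflZ, neg_sub]

/-- The gradient of the kernel of the operator `A ^ (-17/12)` on the half-space. -/
def gradKernel {L : ℝ} (hL : 0 < L) (j : Fin 3) (x : E3) : L2C :=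
  resH (𝓕⁻ (oddGradSymbol hL j x))

theorem continuous_gradKernel {L : ℝ} (hL : 0 < L) (j : Fin 3) :
    Continuous (gradKernel hL j) := by
  refine resH.continuous.comp ((Lp.fourierTransformₗᵢ E3 ℂ).symm.continuous.comp ?_)
  exact (continuous_gradSymbolLp hL j).sub
    ((Lp.compIsometry reflZ).continuous.comp (continuous_gradSymbolLp hL j))

theorem gradSymbol_neg (L : ℝ) (j : Fin 3) (x k : E3) :
    gradSymbol L j x (-k) = star (gradSymbol L j x k) := by
  have : dirichletSymbol L (-k) = dirichletSymbol L k := by simp [dirichletSymbol]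
  simp only [gradSymbol, this, Complex.star_def, map_mul, map_neg, ← Complex.exp_conj]
  simp [map_ofNat]

/-- The symbol is Hermitian in k, hence its inverse Fourier transform is real. White noise is only
paired with real functions. -/
theorem star_gradKernel {L : ℝ} (hL : 0 < L) (j : Fin 3) (x : E3) :
    ∀ᵐ y ∂volH, star (gradKernel hL j x y) = gradKernel hL j x y := by
  set B : L2F := 𝓕⁻ (oddGradSymbol hL j x) with hB
  have h : star B = B := by
    apply Lp.star_eq_self_of_fourier
    rw [hB, FourierTransform.fourier_fourierInv_eq]
    have hn := (LinearIsometryEquiv.neg ℝ (E := E3)).measurePreserving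
    filter_upwards [coeFn_oddGradSymbol hL j x,
      hn.quasiMeasurePreserving.ae (coeFn_oddGradSymbol hL j x)] with k h1 h2
    rw [LinearIsometryEquiv.coe_neg] at h2
    rw [h1, h2, map_neg, gradSymbol_neg, gradSymbol_neg, star_sub]
  have h1 : ∀ᵐ y ∂volH, star (B y) = B y := by
    apply ae_restrict_of_ae
    filter_upwards [Lp.coeFn_star B] with y hy
    rw [← Pi.star_apply, ← hy, h]
  filter_upwards [h1, coeFn_resH B] with y h2 h3
  rw [gradKernel, h3, h2]

end GradientKernel

/-! ### Pairing the kernel with test functions, and its norm -/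

section KernelPairing

open SchwartzMap FourierTransform

theorem integrable_testFunction_smul {F : Type*} [NormedAddCommGroup F] [NormedSpace ℝ F]
    {m : Measure E3} [IsFiniteMeasureOnCompacts m] {Ω : TopologicalSpace.Opens E3} (η : 𝓓(Ω, ℝ))
    {K : E3 → F} (hK : Continuous K) : Integrable (fun x => η x • K x) m :=
  (η.continuous.smul hK).integrable_of_hasCompactSupport η.hasCompactSupport.smul_right

theorem inner_toLp_conj (s : 𝓢(E3, ℂ)) (h : L2F) :
    inner ℂ (s.conj.toLp 2 volume) h = ∫ k, h k * s k := by
  rw [L2.inner_def]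
  apply integral_congr_ae
  filter_upwards [s.conj.coeFn_toLp 2] with k hk
  rw [hk, SchwartzMap.conj_apply, RCLike.inner_apply, Complex.star_def, Complex.conj_conj]

theorem integral_smul_gradSymbol (L : ℝ) (j : Fin 3) {Ω : TopologicalSpace.Opens E3} (η : 𝓓(Ω, ℝ))
    (k : E3) : ∫ x, (η x : ℂ) * gradSymbol L j x k =
      -((dirichletSymbol L k ^ (-(17 / 12) : ℝ) : ℝ) : ℂ) * 𝓕 (∂_{e3 j} η.toSchwartz) k := by
  have h1 : 𝓕 (∂_{e3 j} η.toSchwartz) k = 2 * Real.pi * Complex.I * k j * 𝓕 η.toSchwartz k := by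
    rw [SchwartzMap.fourier_lineDerivOp_eq, smul_apply,
      smulLeftCLM_apply_apply (hasTemperateGrowth_inner_e3 j), inner_e3, smul_eq_mul,
      Complex.real_smul]
    ring
  rw [h1, fourier_coe, Real.fourier_eq', ← integral_const_mul, ← integral_const_mul]
  congr 1; ext x
  rw [gradSymbol, smul_eq_mul, TestFunction.toSchwartz_apply]
  ring

/-- Connects the Bochner integral in L² with the pointwise integral in k: both have the same
pairings with Schwartz functions, by Fubini. -/
theorem coeFn_integral_smul_gradSymbolLp {L : ℝ} (hL : 0 < L) (j : Fin 3)
    {Ω : TopologicalSpace.Opens E3} (η : 𝓓(Ω, ℝ)) :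
    (∫ x, η x • gradSymbolLp hL j x : L2F) =ᵐ[volume] fun k =>
      -((dirichletSymbol L k ^ (-(17 / 12) : ℝ) : ℝ) : ℂ) * 𝓕 (∂_{e3 j} η.toSchwartz) k := by
  refine ae_eq_of_integral_mul_schwartz (MemLp.locallyIntegrable_two (Lp.memLp _)) ?_ fun s => ?_
  · apply Continuous.locallyIntegrable
    have h1 := continuous_dirichletSymbol_rpow L (-(17 / 12))
    have h2 := (𝓕 (∂_{e3 j} η.toSchwartz)).continuous
    fun_prop
  have hi := integrable_testFunction_smul (m := volume) η (continuous_gradSymbolLp hL j)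
  have h1 := (innerSL ℂ (s.conj.toLp 2 volume)).integral_comp_comm hi
  simp only [innerSL_apply_apply] at h1
  rw [← inner_toLp_conj, ← h1]
  have h2 : ∀ x, inner ℂ (s.conj.toLp 2 volume) (η x • gradSymbolLp hL j x) =
      ∫ k, (η x : ℂ) * gradSymbol L j x k * s k := by
    intro x
    rw [inner_smul_right_eq_smul, inner_toLp_conj, Complex.real_smul, ← integral_const_mul]
    apply integral_congr_ae
    filter_upwards [coeFn_gradSymbolLp hL j x] with k hk
    rw [hk, mul_assoc]
  simp only [h2]
  rw [integral_integral_swap]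
  · congr 1; ext k
    rw [integral_mul_const, integral_smul_gradSymbol]
  · have hη : Integrable (fun x => (η x : ℂ)) volume :=
      (η.continuous.integrable_of_hasCompactSupport η.hasCompactSupport).ofReal
    have hs : Integrable (fun k => gradSymbol L j 0 k * s k) :=
      MemLp.integrable_mul (memLp_gradSymbol hL j 0) (s.memLp 2)
    refine (hη.mul_prod hs).mono (Continuous.aestronglyMeasurable ?_)
      (Eventually.of_forall fun p => ?_)
    · have h1 := (continuous_dirichletSymbol_rpow L (-(17 / 12))).comp
        (continuous_snd (X := E3) (Y := E3))
      have h2 := η.continuous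
      have h3 := s.continuous
      simp only [Function.comp_def] at h1
      unfold Function.uncurry gradSymbol
      fun_prop
    · simp only [Function.uncurry, norm_mul, norm_gradSymbol, mul_assoc]
      exact le_rfl

/-- The complexification of a real square-integrable function. -/
def ofRealLp : L2R →L[ℝ] L2C := Complex.ofRealCLM.compLpL 2 volH

theorem coeFn_ofRealLp (φ : L2R) : ofRealLp φ =ᵐ[volH] fun x => (φ x : ℂ) :=
  Complex.ofRealCLM.coeFn_compLpL φ

theorem norm_ofRealLp (φ : L2R) : ‖ofRealLp φ‖ = ‖φ‖ := by
  rw [Lp.norm_def, Lp.norm_def]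
  congr 1
  apply eLpNorm_congr_norm_ae
  filter_upwards [coeFn_ofRealLp φ] with x hx
  rw [hx, Complex.norm_real]

/-- The real-valued version of `gradKernel`. -/
def gradKernelR {L : ℝ} (hL : 0 < L) (j : Fin 3) (x : E3) : L2R :=
  Complex.reCLM.compLpL 2 volH (gradKernel hL j x)

theorem continuous_gradKernelR {L : ℝ} (hL : 0 < L) (j : Fin 3) :
    Continuous (gradKernelR hL j) :=
  (Complex.reCLM.compLpL 2 volH).continuous.comp (continuous_gradKernel hL j)

theorem ofRealLp_gradKernelR {L : ℝ} (hL : 0 < L) (j : Fin 3) (x : E3) :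
    ofRealLp (gradKernelR hL j x) = gradKernel hL j x := by
  apply Lp.ext
  filter_upwards [coeFn_ofRealLp (gradKernelR hL j x),
    Complex.reCLM.coeFn_compLpL (gradKernel hL j x), star_gradKernel hL j x] with y h1 h2 h3
  rw [h1, gradKernelR, h2]
  exact Complex.conj_eq_iff_re.1 h3

theorem oddExt_resH_of_eq_zero {h : L2F} (hh : ∀ᵐ x, x ∉ (halfSpace : Set E3) → h x = 0) :
    oddExt (resH h) = h - Lp.compIsometry reflZ h := by
  have h1 : ∀ᵐ x, (halfSpace : Set E3).indicator (resH h) x = h x := by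
    have h2 : ∀ᵐ x, x ∈ (halfSpace : Set E3) → resH h x = h x :=
      (ae_restrict_iff' measurableSet_halfSpace).1 (coeFn_resH h)
    filter_upwards [hh, h2] with x h3 h4
    by_cases hx : x ∈ (halfSpace : Set E3)
    · rw [Set.indicator_of_mem hx, h4 hx]
    · rw [Set.indicator_of_notMem hx, h3 hx]
  apply Lp.ext
  filter_upwards [coeFn_oddExt (resH h), h1, reflZ.measurePreserving.quasiMeasurePreserving.ae h1,
    Lp.coeFn_sub h (Lp.compIsometry reflZ h), Lp.coeFn_compIsometry reflZ h] with x e1 e2 e3 e4 e5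
  rw [e1, e2, e3, e4, Pi.sub_apply, e5]

theorem fourier_oddExt_testFunction (η : 𝓓(halfSpace, ℝ)) :
    𝓕 (oddExt (resH (η.toSchwartz.toLp 2 volume))) =
      (𝓕 η.toSchwartz).toLp 2 volume -
        Lp.compIsometry reflZ ((𝓕 η.toSchwartz).toLp 2 volume) := by
  rw [oddExt_resH_of_eq_zero]
  · change Lp.fourierTransformₗᵢ E3 ℂ _ = _
    rw [map_sub]
    change 𝓕 (η.toSchwartz.toLp 2 volume) - 𝓕 (Lp.compIsometry reflZ _) = _
    rw [Lp.fourier_compIsometry, SchwartzMap.toLp_fourier_eq]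
  · filter_upwards [η.toSchwartz.coeFn_toLp 2] with x hx hm
    rw [hx, TestFunction.toSchwartz_apply, η.eq_zero_of_notMem hm, Complex.ofReal_zero]

theorem integral_volH_testFunction_smul {F : Type*} [NormedAddCommGroup F] [NormedSpace ℝ F]
    (η : 𝓓(halfSpace, ℝ)) (K : E3 → F) : ∫ x, η x • K x ∂volH = ∫ x, η x • K x :=
  setIntegral_eq_integral_of_forall_compl_eq_zero fun x hx => by
    rw [η.eq_zero_of_notMem hx, zero_smul]

/-- Smearing the kernel with η and changing sign gives A^(-17/12)∂_jη. On the Fourier side the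
smeared symbol is -σ^(-17/12) times the transform of ∂_jη, and antisymmetrization commutes with the
even factor σ^(-17/12). -/
theorem fracPow_integral_gradKernelR {L : ℝ} (hL : 0 < L) (j : Fin 3) (η : 𝓓(halfSpace, ℝ)) :
    FracPow (DirichletOp L) (17 / 12) (ofRealLp (-∫ x, η x • gradKernelR hL j x ∂volH))
      (resH ((∂_{e3 j} η).toSchwartz.toLp 2 volume)) := by
  apply fracPow_dirichletOp hL
  set q : L2F := ∫ x, η x • gradSymbolLp hL j x with hq
  have hqi := integrable_testFunction_smul (m := volume) η (continuous_gradSymbolLp hL j)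
  have h1 : ofRealLp (-∫ x, η x • gradKernelR hL j x ∂volH) =
      -resH (𝓕⁻ (q - Lp.compIsometry reflZ q)) := by
    rw [map_neg, ← ofRealLp.integral_comp_comm
      (integrable_testFunction_smul η (continuous_gradKernelR hL j))]
    simp only [map_smul, ofRealLp_gradKernelR]
    rw [integral_volH_testFunction_smul]
    -- Antisymmetrization, inverse Fourier transform and restriction form one continuous linear map,
    -- so the Bochner integral passes through all three at once.
    let T : L2F →L[ℝ] L2C := (resH ∘L
      ((Lp.fourierTransformₗᵢ E3 ℂ).symm.toContinuousLinearEquiv : L2F →L[ℂ] L2F) ∘L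
      (ContinuousLinearMap.id ℂ L2F -
        (Lp.compIsometry reflZ).toContinuousLinearMap)).restrictScalars ℝ
    have h2 := T.integral_comp_comm hqi
    simp only [map_smul] at h2
    exact congrArg (fun z => -z) h2
  have hodd := compIsometry_sub_compIsometry q
  have h3 : (𝓕 (oddExt (-resH (𝓕⁻ (q - Lp.compIsometry reflZ q)))) : L2F) =
      -(q - Lp.compIsometry reflZ q) := by
    rw [map_neg, oddExt_resH (compIsometry_fourierInv hodd)]
    change Lp.fourierTransformₗᵢ E3 ℂ (-_) = _
    rw [map_neg]
    exact congrArg (fun z => -z)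
      ((Lp.fourierTransformₗᵢ E3 ℂ).apply_symm_apply (q - Lp.compIsometry reflZ q))
  rw [h1, h3, fourier_oddExt_testFunction, TestFunction.toSchwartz_lineDeriv]
  set S := (𝓕 (∂_{e3 j} η.toSchwartz)) with hS
  have hqS := coeFn_integral_smul_gradSymbolLp hL j η
  rw [← hq, ← hS] at hqS
  have hSL : ∀ᵐ k, S.toLp 2 volume k = S k := S.coeFn_toLp 2 volume
  filter_upwards [Lp.coeFn_sub (S.toLp 2 volume) (Lp.compIsometry reflZ (S.toLp 2 volume)),
    Lp.coeFn_compIsometry reflZ (S.toLp 2 volume), hSL,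
    reflZ.measurePreserving.quasiMeasurePreserving.ae hSL,
    Lp.coeFn_neg (q - Lp.compIsometry reflZ q), Lp.coeFn_sub q (Lp.compIsometry reflZ q),
    Lp.coeFn_compIsometry reflZ q, hqS,
    reflZ.measurePreserving.quasiMeasurePreserving.ae hqS] with k e1 e2 e3 e4 e5 e6 e7 e8 e9
  rw [e1, Pi.sub_apply, e2, e3, e4, e5, Pi.neg_apply, e6, Pi.sub_apply, e7, e8, e9,
    dirichletSymbol_reflZ]
  have h4 : ((dirichletSymbol L k ^ (17 / 12 : ℝ) : ℝ) : ℂ) *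
      ((dirichletSymbol L k ^ (-(17 / 12) : ℝ) : ℝ) : ℂ) = 1 := by
    rw [← Complex.ofReal_mul, ← Real.rpow_add (dirichletSymbol_pos L k)]
    simp
  linear_combination (S (reflZ k) - S k) * h4

theorem norm_exp_sub_sq (A B ε : ℝ) (hε : ε ^ 2 = 1) :
    ‖Complex.exp (A * Complex.I) - ε * Complex.exp (B * Complex.I)‖ ^ 2 =
      2 - 2 * ε * Real.cos (A - B) := by
  rw [← Complex.normSq_eq_norm_sq, Complex.normSq_apply]
  simp only [Complex.sub_re, Complex.sub_im, Complex.re_ofReal_mul, Complex.im_ofReal_mul,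
    Complex.exp_ofReal_mul_I_re, Complex.exp_ofReal_mul_I_im, Real.cos_sub]
  linear_combination Real.sin_sq_add_cos_sq A + ε ^ 2 * Real.sin_sq_add_cos_sq B + hε

theorem inner_sub_inner_reflZ (x k : E3) :
    (-2 * Real.pi * inner ℝ x k) - (-2 * Real.pi * inner ℝ x (reflZ k)) =
      -(4 * Real.pi * x 2 * k 2) := by
  simp only [PiLp.inner_apply, Fin.sum_univ_three, reflZ_apply]
  simp
  ring

/-- Method of images: the kernel is the free one minus its mirror image, and the cosine is the
interference between them, at phase difference 4πz k_z. Its sign depends on j because reflection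
flips k_z but not the horizontal frequencies. -/
theorem norm_gradKernelR_sq {L : ℝ} (hL : 0 < L) (j : Fin 3) (x : E3) :
    ‖gradKernelR hL j x‖ ^ 2 = (2 * Real.pi) ^ 2 * ∫ k : E3,
      k j ^ 2 * dirichletSymbol L k ^ (-(17 / 6) : ℝ) *
        (1 + (if j = 2 then 1 else -1) * Real.cos (4 * Real.pi * x 2 * k 2)) := by
  have h1 : ‖gradKernelR hL j x‖ ^ 2 = 1 / 2 * ‖oddGradSymbol hL j x‖ ^ 2 := by
    rw [← norm_ofRealLp, ofRealLp_gradKernelR, gradKernel, oddGradSymbol,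
      norm_resH_sq (compIsometry_fourierInv (compIsometry_sub_compIsometry _))]
    congr 2
    exact (Lp.fourierTransformₗᵢ E3 ℂ).symm.norm_map _
  rw [h1, L2.norm_sq_eq_integral (𝕜 := ℂ), ← integral_const_mul, ← integral_const_mul]
  apply integral_congr_ae
  filter_upwards [coeFn_oddGradSymbol hL j x] with k hk
  -- The sign that k_j acquires under the reflection. The factor 2 in 2 - 2ε cos cancels the 1/2
  -- from restricting to the half-space.
  set ε : ℝ := if j = 2 then -1 else 1 with hε
  have hε2 : ε ^ 2 = 1 := by rw [hε]; split_ifs <;> norm_num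
  have h2 : gradSymbol L j x k - gradSymbol L j x (reflZ k) =
      -(2 * Real.pi * Complex.I * k j) * ((dirichletSymbol L k ^ (-(17 / 12) : ℝ) : ℝ) : ℂ) *
        (Complex.exp ((-2 * Real.pi * inner ℝ x k : ℝ) * Complex.I) -
          ε * Complex.exp ((-2 * Real.pi * inner ℝ x (reflZ k) : ℝ) * Complex.I)) := by
    have h3 : ((reflZ k j : ℝ) : ℂ) = ε * k j := by
      rw [reflZ_apply, hε]; split_ifs <;> simp
    rw [gradSymbol, gradSymbol, dirichletSymbol_reflZ, h3]
    ring
  have h4 : (if j = 2 then 1 else -1 : ℝ) = -ε := by rw [hε]; split_ifs <;> norm_num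
  rw [hk, h2, norm_mul, mul_pow, norm_exp_sub_sq _ _ _ hε2, inner_sub_inner_reflZ, Real.cos_neg,
    h4, ← dirichletSymbol_rpow_sq]
  have h5 : ‖-(2 * (Real.pi : ℂ) * Complex.I * k j) *
      ((dirichletSymbol L k ^ (-(17 / 12) : ℝ) : ℝ) : ℂ)‖ ^ 2 =
      (2 * Real.pi) ^ 2 * (k j ^ 2 * (dirichletSymbol L k ^ (-(17 / 12) : ℝ)) ^ 2) := by
    simp only [norm_mul, norm_neg, Complex.norm_I, Complex.norm_real, Complex.norm_ofNat,
      Real.norm_eq_abs, mul_pow, sq_abs]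
    ring
  rw [h5]
  ring

end KernelPairing

/-! ### White noise representation of the velocity -/

section Velocity

open scoped ContDiff RealInnerProductSpace

variable {Ω : Type*} [MeasurableSpace Ω] {P : Measure Ω}

theorem integral_mul_eq_inner {α : Type*} [MeasurableSpace α] {m : Measure α} (f g : Lp ℝ 2 m) :
    ∫ x, f x * g x ∂m = ⟪f, g⟫ := by
  rw [L2.inner_def]
  congr 1; ext x
  simp [mul_comm]

theorem IsWhiteNoise.inner {ξ : Fin 3 → L2R → Lp ℝ 2 P} (h : IsWhiteNoise P ξ) (i j : Fin 3)
    (f g : L2R) : ⟪ξ i f, ξ j g⟫ = if i = j then ⟪f, g⟫ else 0 := by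
  rw [← integral_mul_eq_inner, h.covariance, integral_mul_eq_inner]

/-- A map between real inner product spaces that preserves inner products is linear. -/
def LinearIsometry.ofInner {E F : Type*} [NormedAddCommGroup E] [InnerProductSpace ℝ E]
    [NormedAddCommGroup F] [InnerProductSpace ℝ F] (T : E → F)
    (hT : ∀ x y, ⟪T x, T y⟫ = ⟪x, y⟫) : E →ₗᵢ[ℝ] F where
  toFun := T
  map_add' x y := by
    -- The squared norm of T(x + y) - (Tx + Ty) expands into inner products, which cancel as they do
    -- for x + y - (x + y). In this way linearity of white noise follows from its covariance.
    rw [← sub_eq_zero, ← inner_self_eq_zero (𝕜 := ℝ)]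
    simp only [inner_sub_left, inner_sub_right, inner_add_left, inner_add_right, hT]
    ring
  map_smul' c x := by
    rw [← sub_eq_zero, ← inner_self_eq_zero (𝕜 := ℝ)]
    simp only [inner_sub_left, inner_sub_right, inner_smul_left, inner_smul_right, hT,
      RingHom.id_apply]
    simp
  norm_map' x := by
    change ‖T x‖ = ‖x‖
    rw [← sq_eq_sq₀ (norm_nonneg _) (norm_nonneg _), ← real_inner_self_eq_norm_sq, hT,
      real_inner_self_eq_norm_sq]

/-- White noise as a linear isometry. -/
def IsWhiteNoise.isometry {ξ : Fin 3 → L2R → Lp ℝ 2 P} (h : IsWhiteNoise P ξ) (i : Fin 3) :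
    L2R →ₗᵢ[ℝ] Lp ℝ 2 P :=
  LinearIsometry.ofInner (ξ i) fun f g => by rw [h.inner, if_pos rfl]

theorem IsWhiteNoise.isometry_apply {ξ : Fin 3 → L2R → Lp ℝ 2 P} (h : IsWhiteNoise P ξ)
    (i : Fin 3) (f : L2R) : h.isometry i f = ξ i f := rfl

variable {L μ : ℝ} {ξ : Fin 3 → L2R → Lp ℝ 2 P} {ψ : Fin 3 → RandomDistribution P}

/-- The partial derivative `∂ⱼ ψᵢ` of a von Kármán solution as a random field. -/
def partialField (hL : 0 < L) (μ : ℝ) (ξ : Fin 3 → L2R → Lp ℝ 2 P) (j i : Fin 3) (x : E3) :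
    Lp ℝ 2 P :=
  (μ * L ^ (17 / 6 : ℝ)) • ξ i (gradKernelR hL j x)

theorem continuous_partialField (hL : 0 < L) (hξ : IsWhiteNoise P ξ) (j i : Fin 3) :
    Continuous (partialField hL μ ξ j i) := by
  have h := (hξ.isometry i).continuous.comp (continuous_gradKernelR hL j)
  exact h.const_smul (μ * L ^ (17 / 6 : ℝ))

theorem distPartial_eq_integral (hL : 0 < L) (hξ : IsWhiteNoise P ξ)
    (hψ : IsVonKarmanSolution P L μ ξ ψ) (j i : Fin 3) (η : 𝓓(halfSpace, ℝ)) :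
    distPartial j (ψ i) η = ∫ x, η x • partialField hL μ ξ j i x ∂volH := by
  -- The equation is tested with φ = A^(-17/12)∂_jη, for which A^(17/12)φ = ∂_jη is a test function.
  -- The minus sign of φ cancels the one in the distributional derivative.
  have h1 := hψ i (-∫ x, η x • gradKernelR hL j x ∂volH) (∂_{e3 j} η) _ _ (coeFn_ofRealLp _) ?_
    (fracPow_integral_gradKernelR hL j η)
  · rw [distPartial, h1, ← hξ.isometry_apply, map_neg, smul_neg, neg_neg]
    have h2 := (hξ.isometry i).toContinuousLinearMap.integral_comp_comm
      (integrable_testFunction_smul (m := volH) η (continuous_gradKernelR hL j))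
    rw [LinearIsometry.coe_toContinuousLinearMap] at h2
    rw [← h2, ← integral_smul]
    congr 1; ext1 x
    rw [map_smul, smul_comm]
    rfl
  · have h2 : ∀ᵐ x ∂volH, (∂_{e3 j} η).toSchwartz.toLp 2 volume x = ((∂_{e3 j} η) x : ℂ) :=
      ae_restrict_of_ae ((∂_{e3 j} η).toSchwartz.coeFn_toLp 2 volume)
    filter_upwards [h2, coeFn_resH ((∂_{e3 j} η).toSchwartz.toLp 2 volume)] with x e1 e2
    rw [e2, e1]

/-- The velocity field of a von Kármán solution. -/
def velocityField (hL : 0 < L) (μ : ℝ) (ξ : Fin 3 → L2R → Lp ℝ 2 P) (i : Fin 3) (x : E3) :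
    Lp ℝ 2 P :=
  ![partialField hL μ ξ 1 2 x - partialField hL μ ξ 2 1 x,
    partialField hL μ ξ 2 0 x - partialField hL μ ξ 0 2 x,
    partialField hL μ ξ 0 1 x - partialField hL μ ξ 1 0 x] i

theorem isVelocity_velocityField (hL : 0 < L) (hξ : IsWhiteNoise P ξ)
    (hψ : IsVonKarmanSolution P L μ ξ ψ) : IsVelocity ψ (velocityField hL μ ξ) := by
  have hc := fun j i => continuous_partialField (μ := μ) hL hξ j i
  constructor
  · intro i
    apply Continuous.continuousOn
    fin_cases i
    · exact (hc 1 2).sub (hc 2 1)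
    · exact (hc 2 0).sub (hc 0 2)
    · exact (hc 0 1).sub (hc 1 0)
  · intro i η
    have key : ∀ j i j' i', ∫ x, η x • (partialField hL μ ξ j i x - partialField hL μ ξ j' i' x)
        ∂volH = distPartial j (ψ i) η - distPartial j' (ψ i') η := by
      intro j i j' i'
      simp only [smul_sub]
      rw [integral_sub (integrable_testFunction_smul η (hc j i))
        (integrable_testFunction_smul η (hc j' i')), distPartial_eq_integral hL hξ hψ,
        distPartial_eq_integral hL hξ hψ]
    fin_cases i
    · exact key 1 2 2 1
    · exact key 2 0 0 2
    · exact key 0 1 1 0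

/-- Equal pairings with all test functions give equality almost everywhere, and mean-square
continuity upgrades this to every point of the half-space. -/
theorem IsVelocity.eqOn {u v : Fin 3 → E3 → Lp ℝ 2 P} (hu : IsVelocity ψ u) (hv : IsVelocity ψ v)
    (i : Fin 3) : Set.EqOn (u i) (v i) (halfSpace : Set E3) := by
  have hopen : IsOpen (halfSpace : Set E3) := halfSpace.isOpen
  have hcont := (hu.continuousOn i).sub (hv.continuousOn i)
  have hint : ∀ {w : E3 → Lp ℝ 2 P}, ContinuousOn w (halfSpace : Set E3) → ∀ η : 𝓓(halfSpace, ℝ),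
      Integrable (fun x => η x • w x) volH := by
    intro w hw η
    refine Continuous.integrable_of_hasCompactSupport ?_ η.hasCompactSupport.smul_right
    exact (η.continuous.continuousOn.smul hw).continuous_of_tsupport_subset hopen
      ((tsupport_smul_subset_left _ _).trans η.tsupport_subset)
  have h0 := hopen.ae_eq_zero_of_integral_contDiff_smul_eq_zero (μ := volume)
    (hcont.locallyIntegrableOn measurableSet_halfSpace) fun g hg hgc hgs => by
      let η : 𝓓(halfSpace, ℝ) := ⟨g, hg, hgc, hgs⟩
      change ∫ x, η x • (u i - v i) x = 0
      rw [← integral_volH_testFunction_smul]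
      simp only [Pi.sub_apply, smul_sub]
      rw [integral_sub (hint (hu.continuousOn i) η) (hint (hv.continuousOn i) η), hu.eq_curl,
        hv.eq_curl, sub_self]
  refine Measure.eqOn_open_of_ae_eq (μ := volume) ?_ hopen (hu.continuousOn i) (hv.continuousOn i)
  refine (ae_restrict_iff' measurableSet_halfSpace).2 ?_
  filter_upwards [h0] with x hx hm
  exact sub_eq_zero.1 (hx hm)

/-- Distinct components of the noise are uncorrelated, so the cross term vanishes and the variances
add. -/
theorem norm_partialField_sub_sq (hL : 0 < L) (hξ : IsWhiteNoise P ξ) {j i j' i' : Fin 3}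
    (hi : i ≠ i') (x : E3) :
    ‖partialField hL μ ξ j i x - partialField hL μ ξ j' i' x‖ ^ 2 =
      (μ * L ^ (17 / 6 : ℝ)) ^ 2 * (‖gradKernelR hL j x‖ ^ 2 + ‖gradKernelR hL j' x‖ ^ 2) := by
  rw [partialField, partialField, ← smul_sub, norm_smul, mul_pow, norm_sub_sq_real, hξ.inner,
    if_neg hi, ← hξ.isometry_apply, ← hξ.isometry_apply, LinearIsometry.norm_map,
    LinearIsometry.norm_map, Real.norm_eq_abs, sq_abs]
  ring

theorem IsVelocity.reynoldsStress_zero (hL : 0 < L) (hξ : IsWhiteNoise P ξ)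
    (hψ : IsVonKarmanSolution P L μ ξ ψ) {u : Fin 3 → E3 → Lp ℝ 2 P} (hu : IsVelocity ψ u)
    {x : E3} (hx : x ∈ halfSpace) : reynoldsStress u 0 0 x =
      (μ * L ^ (17 / 6 : ℝ)) ^ 2 * (‖gradKernelR hL 1 x‖ ^ 2 + ‖gradKernelR hL 2 x‖ ^ 2) := by
  rw [reynoldsStress, integral_mul_eq_inner, real_inner_self_eq_norm_sq,
    hu.eqOn (isVelocity_velocityField hL hξ hψ) 0 hx]
  exact norm_partialField_sub_sq hL hξ (by decide) x

theorem IsVelocity.reynoldsStress_one (hL : 0 < L) (hξ : IsWhiteNoise P ξ)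
    (hψ : IsVonKarmanSolution P L μ ξ ψ) {u : Fin 3 → E3 → Lp ℝ 2 P} (hu : IsVelocity ψ u)
    {x : E3} (hx : x ∈ halfSpace) : reynoldsStress u 1 1 x =
      (μ * L ^ (17 / 6 : ℝ)) ^ 2 * (‖gradKernelR hL 0 x‖ ^ 2 + ‖gradKernelR hL 2 x‖ ^ 2) := by
  rw [reynoldsStress, integral_mul_eq_inner, real_inner_self_eq_norm_sq,
    hu.eqOn (isVelocity_velocityField hL hξ hψ) 1 hx, add_comm]
  exact norm_partialField_sub_sq hL hξ (by decide) x

end Velocity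

/-! ### Gaussian moments with a cosine -/

section GaussianMoments

open Real (pi)

theorem integrable_sq_mul_gaussian {b : ℝ} (hb : 0 < b) :
    Integrable fun x : ℝ => x ^ 2 * Real.exp (-b * x ^ 2) := by
  have := integrable_rpow_mul_exp_neg_mul_sq hb (s := 2) (by norm_num)
  simpa using this

theorem integral_gaussian_mul_cos {b : ℝ} (hb : 0 < b) (a : ℝ) :
    ∫ x : ℝ, Real.exp (-b * x ^ 2) * Real.cos (a * x) =
      √(Real.pi / b) * Real.exp (-(a ^ 2 / (4 * b))) := by
  have h := fourierIntegral_gaussian (b := b) (by simpa using hb) a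
  have h1 : ∀ x : ℝ, (Complex.exp (Complex.I * a * x) * Complex.exp (-b * x ^ 2)).re =
      Real.exp (-b * x ^ 2) * Real.cos (a * x) := by
    intro x
    rw [show Complex.I * a * x = ((a * x : ℝ) : ℂ) * Complex.I by push_cast; ring,
      show -(b : ℂ) * x ^ 2 = ((-b * x ^ 2 : ℝ) : ℂ) by push_cast; ring, ← Complex.ofReal_exp,
      Complex.re_mul_ofReal, Complex.exp_ofReal_mul_I_re, mul_comm]
  have h2 : ((Real.pi : ℂ) / b) ^ (1 / 2 : ℂ) * Complex.exp (-a ^ 2 / (4 * b)) =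
      ((√(Real.pi / b) * Real.exp (-(a ^ 2 / (4 * b))) : ℝ) : ℂ) := by
    rw [Real.sqrt_eq_rpow, Complex.ofReal_mul, Complex.ofReal_cpow (by positivity),
      Complex.ofReal_exp]
    push_cast
    congr 2
    ring
  have hi : Integrable fun x : ℝ => Complex.exp (Complex.I * a * x) * Complex.exp (-b * x ^ 2) := by
    have := GaussianFourier.integrable_cexp_neg_mul_sq_add_real_mul_I (b := b) (by simpa using hb) 0
    have h3 : Integrable fun x : ℝ => Complex.exp (-b * x ^ 2) := by simpa using this
    refine h3.mono (by fun_prop) (Eventually.of_forall fun x => ?_)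
    rw [norm_mul, show Complex.I * a * x = ((a * x : ℝ) : ℂ) * Complex.I by push_cast; ring,
      Complex.norm_exp_ofReal_mul_I, one_mul]
  rw [h2] at h
  have h4 := congrArg Complex.re h
  rw [Complex.ofReal_re] at h4
  rw [← h4, ← Complex.reCLM_apply, ← ContinuousLinearMap.integral_comp_comm _ hi]
  simp only [Complex.reCLM_apply, h1]

theorem integral_sq_mul_gaussian_mul_cos {b : ℝ} (hb : 0 < b) (a : ℝ) :
    ∫ x : ℝ, x ^ 2 * Real.exp (-b * x ^ 2) * Real.cos (a * x) =
      (1 / (2 * b) - a ^ 2 / (4 * b ^ 2)) *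
        (√(Real.pi / b) * Real.exp (-(a ^ 2 / (4 * b)))) := by
  have i0 : ∀ {f : ℝ → ℝ}, Integrable f → ∀ {g : ℝ → ℝ}, Continuous g → (∀ x, |g x| ≤ 1) →
      Integrable fun x => f x * g x := fun hf g hg hb =>
    hf.mul_bdd (c := 1) hg.aestronglyMeasurable (Eventually.of_forall hb)
  have hc : Continuous fun x => Real.cos (a * x) := by fun_prop
  have hs : Continuous fun x => Real.sin (a * x) := by fun_prop
  have hcb := fun x => Real.abs_cos_le_one (a * x)
  have hsb := fun x => Real.abs_sin_le_one (a * x)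
  have g0 := integrable_exp_neg_mul_sq hb
  have g1 := integrable_mul_exp_neg_mul_sq hb
  have g2 := integrable_sq_mul_gaussian hb
  have dE : ∀ x : ℝ, HasDerivAt (fun x => Real.exp (-b * x ^ 2))
      (-(2 * b * x) * Real.exp (-b * x ^ 2)) x := by
    intro x
    convert (((hasDerivAt_pow 2 x).const_mul (-b)).exp) using 1
    push_cast; ring
  have dC : ∀ x : ℝ, HasDerivAt (fun x => Real.cos (a * x)) (-(a * Real.sin (a * x))) x := by
    intro x
    refine ((hasDerivAt_id' x).const_mul a).cos.congr_deriv ?_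
    ring
  have dS : ∀ x : ℝ, HasDerivAt (fun x => Real.sin (a * x)) (a * Real.cos (a * x)) x := by
    intro x
    refine ((hasDerivAt_id' x).const_mul a).sin.congr_deriv ?_
    ring
  set C := ∫ x : ℝ, Real.exp (-b * x ^ 2) * Real.cos (a * x) with hC
  set S := ∫ x : ℝ, x * Real.exp (-b * x ^ 2) * Real.sin (a * x) with hS
  set Q := ∫ x : ℝ, x ^ 2 * Real.exp (-b * x ^ 2) * Real.cos (a * x) with hQ
  -- The integral of the derivative of e^(-bx²) sin(ax) vanishes. The next relation comes likewise
  -- from x e^(-bx²) cos(ax), and eliminating `S` gives `Q` in terms of the known `C`.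
  have e1 : a * C - 2 * b * S = 0 := by
    rw [← integral_eq_zero_of_hasDerivAt_of_integrable
      (f := fun x => Real.exp (-b * x ^ 2) * Real.sin (a * x))
      (f' := fun x => a * (Real.exp (-b * x ^ 2) * Real.cos (a * x)) -
        2 * b * (x * Real.exp (-b * x ^ 2) * Real.sin (a * x))) ?_ ?_ (i0 g0 hs hsb),
      integral_sub ((i0 g0 hc hcb).const_mul _) ((i0 g1 hs hsb).const_mul _),
      integral_const_mul, integral_const_mul]
    · intro x
      refine ((dE x).fun_mul (dS x)).congr_deriv ?_
      ring
    · exact ((i0 g0 hc hcb).const_mul _).sub ((i0 g1 hs hsb).const_mul _)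
  have i2 : Integrable fun x : ℝ => 2 * b * (x ^ 2 * Real.exp (-b * x ^ 2) * Real.cos (a * x)) +
      a * (x * Real.exp (-b * x ^ 2) * Real.sin (a * x)) :=
    ((i0 g2 hc hcb).const_mul _).add ((i0 g1 hs hsb).const_mul _)
  have e2 : C - (2 * b * Q + a * S) = 0 := by
    rw [← integral_eq_zero_of_hasDerivAt_of_integrable
      (f := fun x => x * Real.exp (-b * x ^ 2) * Real.cos (a * x))
      (f' := fun x => Real.exp (-b * x ^ 2) * Real.cos (a * x) -
        (2 * b * (x ^ 2 * Real.exp (-b * x ^ 2) * Real.cos (a * x)) +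
        a * (x * Real.exp (-b * x ^ 2) * Real.sin (a * x)))) ?_ ?_ (i0 g1 hc hcb),
      integral_sub (i0 g0 hc hcb) i2, integral_add ((i0 g2 hc hcb).const_mul _)
        ((i0 g1 hs hsb).const_mul _), integral_const_mul, integral_const_mul]
    · intro x
      refine (((hasDerivAt_id' x).fun_mul (dE x)).fun_mul (dC x)).congr_deriv ?_
      ring
    · exact (i0 g0 hc hcb).sub i2
  rw [← integral_gaussian_mul_cos hb a, ← hC]
  field_simp
  linear_combination 2 * a * e1 - 4 * b * e2

theorem integral_euclidean_prod (f : Fin 3 → ℝ → ℝ) :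
    ∫ k : E3, ∏ i, f i (k i) = ∏ i, ∫ t, f i t := by
  rw [← integral_fintype_prod_volume_eq_prod,
    ← (EuclideanSpace.volume_preserving_symm_measurableEquiv_toLp (Fin 3)).integral_comp
      (MeasurableEquiv.measurableEmbedding _)]
  rfl

/-- `∫ kⱼ² exp(-b|k|²) cos(a k₂) dk` for a horizontal direction `j`. -/
theorem integral_coord_sq_gaussian_cos {b : ℝ} (hb : 0 < b) (a : ℝ) {j : Fin 3} (hj : j ≠ 2) :
    ∫ k : E3, k j ^ 2 * Real.exp (-b * ‖k‖ ^ 2) * Real.cos (a * k 2) =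
      √(Real.pi / b) ^ 3 * (1 / (2 * b)) * Real.exp (-(a ^ 2 / (4 * b))) := by
  -- Frequency 0 in the horizontal directions turns the cosine into 1, so all three factors have the
  -- same form.
  have h := integral_euclidean_prod fun i t => (if i = j then t ^ 2 else 1) *
    Real.exp (-b * t ^ 2) * Real.cos ((if i = 2 then a else 0) * t)
  have h1 : ∀ k : E3, ∏ i : Fin 3, (if i = j then k i ^ 2 else 1) * Real.exp (-b * k i ^ 2) *
      Real.cos ((if i = 2 then a else 0) * k i) =
      k j ^ 2 * Real.exp (-b * ‖k‖ ^ 2) * Real.cos (a * k 2) := by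
    intro k
    rw [EuclideanSpace.norm_sq_eq, Finset.prod_mul_distrib, Finset.prod_mul_distrib,
      ← Real.exp_sum, ← Finset.mul_sum]
    simp [Fin.prod_univ_three]
  simp only [h1] at h
  rw [h]
  have c0 := integral_gaussian_mul_cos hb 0
  have q0 := integral_sq_mul_gaussian_mul_cos hb 0
  have ca := integral_gaussian_mul_cos hb a
  fin_cases j
  · simp [Fin.prod_univ_three] at c0 q0 ca ⊢
    rw [c0, q0, ca]; ring
  · simp [Fin.prod_univ_three] at c0 q0 ca ⊢
    rw [c0, q0, ca]; ring
  · simp at hj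

theorem integral_coord_two_sq_gaussian_cos {b : ℝ} (hb : 0 < b) (a : ℝ) :
    ∫ k : E3, k 2 ^ 2 * Real.exp (-b * ‖k‖ ^ 2) * Real.cos (a * k 2) =
      √(Real.pi / b) ^ 3 * (1 / (2 * b) - a ^ 2 / (4 * b ^ 2)) *
        Real.exp (-(a ^ 2 / (4 * b))) := by
  have h := integral_euclidean_prod fun i t => (if i = 2 then t ^ 2 else 1) *
    Real.exp (-b * t ^ 2) * Real.cos ((if i = 2 then a else 0) * t)
  have h1 : ∀ k : E3, ∏ i : Fin 3, (if i = 2 then k i ^ 2 else 1) * Real.exp (-b * k i ^ 2) *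
      Real.cos ((if i = 2 then a else 0) * k i) =
      k 2 ^ 2 * Real.exp (-b * ‖k‖ ^ 2) * Real.cos (a * k 2) := by
    intro k
    rw [EuclideanSpace.norm_sq_eq, Finset.prod_mul_distrib, Finset.prod_mul_distrib,
      ← Real.exp_sum, ← Finset.mul_sum]
    simp [Fin.prod_univ_three]
  simp only [h1] at h
  rw [h]
  have c0 := integral_gaussian_mul_cos hb 0
  have qa := integral_sq_mul_gaussian_mul_cos hb a
  simp [Fin.prod_univ_three] at c0 qa ⊢
  rw [c0, qa]; ring

end GaussianMoments

/-! ### The extended Gamma integral, Bessel functions and the Matérn kernel -/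

section ExtendedGamma

/-- The integral `∫₀^∞ t^(s-1) exp(-t - y/t) dt`. -/
def extGamma (s y : ℝ) : ℝ :=
  ∫ t in Set.Ioi (0 : ℝ), Real.exp (-t) * t ^ (s - 1) * Real.exp (-(y / t))

/-- The integral `∫₀^∞ t^(s-1) (y/t) exp(-t - y/t) dt`. -/
def extGammaDefect (s y : ℝ) : ℝ :=
  ∫ t in Set.Ioi (0 : ℝ), Real.exp (-t) * t ^ (s - 1) * (y / t * Real.exp (-(y / t)))

theorem mul_exp_neg_le_one (u : ℝ) : u * Real.exp (-u) ≤ 1 := by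
  rw [Real.exp_neg, ← div_eq_mul_inv, div_le_one (Real.exp_pos u)]
  linarith [Real.add_one_le_exp u]

theorem integrableOn_gamma_mul {s : ℝ} (hs : 0 < s) {g : ℝ → ℝ} (hg : Measurable g)
    (hb : ∀ t, 0 < t → |g t| ≤ 1) :
    IntegrableOn (fun t => Real.exp (-t) * t ^ (s - 1) * g t) (Set.Ioi 0) :=
  (Real.GammaIntegral_convergent hs).mul_bdd (c := 1) hg.aestronglyMeasurable
    ((ae_restrict_iff' measurableSet_Ioi).2 (Eventually.of_forall hb))

theorem abs_exp_neg_div_le_one {y t : ℝ} (hy : 0 ≤ y) (ht : 0 < t) : |Real.exp (-(y / t))| ≤ 1 := by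
  rw [Real.abs_exp]
  exact Real.exp_le_one_iff.2 (neg_nonpos.2 (by positivity))

theorem abs_div_mul_exp_neg_div_le_one {y t : ℝ} (hy : 0 ≤ y) (ht : 0 < t) :
    |y / t * Real.exp (-(y / t))| ≤ 1 := by
  rw [abs_of_nonneg (by positivity)]
  exact mul_exp_neg_le_one _

theorem integrableOn_extGamma {s y : ℝ} (hs : 0 < s) (hy : 0 ≤ y) :
    IntegrableOn (fun t => Real.exp (-t) * t ^ (s - 1) * Real.exp (-(y / t))) (Set.Ioi 0) :=
  integrableOn_gamma_mul hs (by fun_prop) fun _ ht => abs_exp_neg_div_le_one hy ht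

theorem integrableOn_extGammaDefect {s y : ℝ} (hs : 0 < s) (hy : 0 ≤ y) :
    IntegrableOn (fun t => Real.exp (-t) * t ^ (s - 1) * (y / t * Real.exp (-(y / t))))
      (Set.Ioi 0) :=
  integrableOn_gamma_mul hs (by fun_prop) fun _ ht => abs_div_mul_exp_neg_div_le_one hy ht

theorem extGamma_zero {s : ℝ} (hs : 0 < s) : extGamma s 0 = Real.Gamma s := by
  simp [extGamma, Real.Gamma_eq_integral hs]

theorem extGammaDefect_zero (s : ℝ) : extGammaDefect s 0 = 0 := by simp [extGammaDefect]

/-- Since 0 ≤ u·e^(-u) ≤ 1 for u ≥ 0, the Gamma integrand dominates uniformly in y. The same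
statement therefore covers both y → 0 and y → ∞. -/
theorem tendsto_extGammaDefect {s : ℝ} (hs : 0 < s) {ι : Type*} {l : Filter ι}
    [l.IsCountablyGenerated] {y : ι → ℝ} (hy : ∀ᶠ i in l, 0 ≤ y i)
    (h : ∀ t : ℝ, 0 < t → Tendsto (fun i => y i / t * Real.exp (-(y i / t))) l (𝓝 0)) :
    Tendsto (fun i => extGammaDefect s (y i)) l (𝓝 0) := by
  have h0 : ∫ t in Set.Ioi (0 : ℝ), Real.exp (-t) * t ^ (s - 1) * 0 = 0 := by simp
  rw [← h0]
  apply tendsto_integral_filter_of_dominated_convergence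
    (fun t => Real.exp (-t) * t ^ (s - 1))
  · filter_upwards [hy] with i hi
    exact (integrableOn_extGammaDefect hs hi).1
  · filter_upwards [hy] with i hi
    refine (ae_restrict_iff' measurableSet_Ioi).2 (Eventually.of_forall fun t ht => ?_)
    have ht : 0 < t := ht
    rw [norm_mul, Real.norm_of_nonneg (by positivity)]
    exact mul_le_of_le_one_right (by positivity) (abs_div_mul_exp_neg_div_le_one hi ht)
  · exact Real.GammaIntegral_convergent hs
  · refine (ae_restrict_iff' measurableSet_Ioi).2 (Eventually.of_forall fun t ht => ?_)
    exact (h t ht).const_mul _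

theorem tendsto_extGammaDefect_atTop {s : ℝ} (hs : 0 < s) :
    Tendsto (extGammaDefect s) atTop (𝓝 0) := by
  refine tendsto_extGammaDefect hs (eventually_ge_atTop 0) fun t ht => ?_
  have h := (Real.tendsto_pow_mul_exp_neg_atTop_nhds_zero 1).comp
    (tendsto_id.atTop_div_const ht)
  simpa [Function.comp_def] using h

theorem tendsto_extGammaDefect_zero {s : ℝ} (hs : 0 < s) :
    Tendsto (extGammaDefect s) (𝓝[>] 0) (𝓝 0) := by
  refine tendsto_extGammaDefect hs
    (eventually_nhdsWithin_of_forall fun y (hy : 0 < y) => hy.le) fun t ht => ?_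
  have h : Continuous fun y : ℝ => y / t * Real.exp (-(y / t)) := by fun_prop
  simpa using (h.tendsto 0).mono_left nhdsWithin_le_nhds

/-- Integration by parts. -/
theorem extGamma_add_one {s y : ℝ} (hs : 0 < s) (hy : 0 ≤ y) :
    extGamma (s + 1) y = s * extGamma s y + extGammaDefect s y := by
  have i1 := integrableOn_extGamma hs hy
  have i2 := integrableOn_extGamma (by linarith : 0 < s + 1) hy
  have i3 := integrableOn_extGammaDefect hs hy
  have hi := ((i1.const_mul s).add i3).sub i2
  -- The function t^s e^(-t-y/t) vanishes at both ends; differentiating its three factors gives the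
  -- three integrals of the recurrence.
  have key := integral_Ioi_of_hasDerivAt_of_tendsto (a := 0) (m := 0)
    (f := fun t : ℝ => t ^ s * (Real.exp (-t) * Real.exp (-(y / t)))) ?_ ?_ hi ?_
  · simp only [Pi.sub_apply, Pi.add_apply] at key
    have i13 : IntegrableOn (fun t => s * (Real.exp (-t) * t ^ (s - 1) * Real.exp (-(y / t))) +
        Real.exp (-t) * t ^ (s - 1) * (y / t * Real.exp (-(y / t)))) (Set.Ioi 0) :=
      (i1.const_mul s).add i3
    rw [integral_sub i13 i2, integral_add (i1.const_mul s) i3, integral_const_mul,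
      Real.zero_rpow hs.ne'] at key
    unfold extGamma extGammaDefect
    linarith
  -- At t = 0 the convention y/0 = 0 is harmless: the factor t^s with s > 0 makes the boundary value
  -- 0.
  · rw [ContinuousWithinAt, Real.zero_rpow hs.ne', zero_mul]
    have h1 : Tendsto (fun t : ℝ => t ^ s) (𝓝[Set.Ici 0] 0) (𝓝 0) := by
      have := (Real.continuousAt_rpow_const 0 s (Or.inr hs.le)).tendsto
      rw [Real.zero_rpow hs.ne'] at this
      exact this.mono_left nhdsWithin_le_nhds
    refine squeeze_zero' ?_ ?_ h1
    · filter_upwards [self_mem_nhdsWithin] with t (ht : 0 ≤ t)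
      positivity
    · filter_upwards [self_mem_nhdsWithin] with t (ht : 0 ≤ t)
      refine mul_le_of_le_one_right (by positivity) ?_
      rw [← Real.exp_add, Real.exp_le_one_iff]
      have : 0 ≤ y / t := by positivity
      linarith
  · intro t ht
    have ht : 0 < t := ht
    have d1 := Real.hasDerivAt_rpow_const (p := s) (Or.inl ht.ne')
    have d2 := (hasDerivAt_neg t).exp
    have d3 := ((hasDerivAt_inv ht.ne').const_mul y).neg.exp
    have d4 := d1.fun_mul (d2.fun_mul d3)
    refine d4.congr_deriv ?_
    have e1 : t ^ (s + 1 - 1) = t * t ^ (s - 1) := by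
      rw [← Real.rpow_one_add' ht.le (by simpa using hs.ne')]; congr 1; ring
    have e2 : t ^ s = t * t ^ (s - 1) := by rw [← e1, add_sub_cancel_right]
    simp only [Pi.sub_apply, Pi.add_apply, Pi.neg_apply, e1, e2, ← div_eq_mul_inv]
    field_simp
    ring
  · have h1 : Tendsto (fun t : ℝ => t ^ s * Real.exp (-1 * t)) atTop (𝓝 0) :=
      tendsto_rpow_mul_exp_neg_mul_atTop_nhds_zero s 1 one_pos
    refine squeeze_zero' ?_ ?_ h1
    · filter_upwards [eventually_gt_atTop 0] with t ht
      positivity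
    · filter_upwards [eventually_gt_atTop 0] with t ht
      rw [neg_one_mul]
      refine mul_le_mul_of_nonneg_left ?_ (by positivity)
      exact mul_le_of_le_one_right (by positivity)
        ((le_abs_self _).trans (abs_exp_neg_div_le_one hy ht))

theorem extGamma_eq_besselK {ν x : ℝ} (hν : 0 < ν) (hx : 0 < x) :
    extGamma ν ((x / 2) ^ 2) = 2 * (x / 2) ^ ν * besselK ν x := by
  set c := x / 2 with hc
  have hc0 : 0 < c := by positivity
  have himg : (fun s : ℝ => c * Real.exp s) '' Set.univ = Set.Ioi 0 := by
    ext t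
    simp only [Set.image_univ, Set.mem_range, Set.mem_Ioi]
    constructor
    · rintro ⟨s, rfl⟩; positivity
    · intro ht
      exact ⟨Real.log (t / c), by rw [Real.exp_log (by positivity)]; field_simp⟩
  have hder : ∀ s ∈ Set.univ, HasDerivWithinAt (fun s : ℝ => c * Real.exp s) (c * Real.exp s)
      Set.univ s := fun s _ => ((Real.hasDerivAt_exp s).const_mul c).hasDerivWithinAt
  have hinj : Set.InjOn (fun s : ℝ => c * Real.exp s) Set.univ := by
    intro a _ b _ hab
    exact Real.exp_injective (mul_left_cancel₀ hc0.ne' hab)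
  -- Under t = c·e^s with c = x/2, the exponent t + c²/t becomes 2c cosh s = x cosh s.
  have hval : ∀ s : ℝ, |c * Real.exp s| • (Real.exp (-(c * Real.exp s)) *
      (c * Real.exp s) ^ (ν - 1) * Real.exp (-(c ^ 2 / (c * Real.exp s)))) =
      c ^ ν * (Real.exp (ν * s) * Real.exp (-(x * Real.cosh s))) := by
    intro s
    have hpos : 0 < c * Real.exp s := by positivity
    have e1 : (c * Real.exp s) * (c * Real.exp s) ^ (ν - 1) = c ^ ν * Real.exp (ν * s) := by
      rw [← Real.rpow_one_add' hpos.le (by simpa using hν.ne'), add_sub_cancel,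
        Real.mul_rpow hc0.le (Real.exp_pos s).le, ← Real.exp_mul, mul_comm s]
    have e2 : Real.exp (-(c * Real.exp s)) * Real.exp (-(c ^ 2 / (c * Real.exp s))) =
        Real.exp (-(x * Real.cosh s)) := by
      rw [← Real.exp_add, Real.cosh_eq, Real.exp_neg s]
      congr 1
      have := Real.exp_pos s
      rw [hc]
      field_simp
      ring
    rw [abs_of_pos hpos, smul_eq_mul, ← e2, ← mul_assoc (c ^ ν), ← e1]
    ring
  have hI := integrableOn_extGamma hν (sq_nonneg c)
  rw [← himg, integrableOn_image_iff_integrableOn_abs_deriv_smul MeasurableSet.univ hder hinj,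
    integrableOn_univ] at hI
  simp only [hval] at hI
  have h1 : extGamma ν (c ^ 2) =
      ∫ s : ℝ, c ^ ν * (Real.exp (ν * s) * Real.exp (-(x * Real.cosh s))) := by
    rw [extGamma, ← himg, integral_image_eq_integral_abs_deriv_smul MeasurableSet.univ hder hinj,
      setIntegral_univ]
    simp only [hval]
  have h2 : extGamma ν (c ^ 2) =
      ∫ s : ℝ, c ^ ν * (Real.exp (-(ν * s)) * Real.exp (-(x * Real.cosh s))) := by
    rw [h1, ← integral_neg_eq_self]
    simp
  have hI2 : Integrable fun s : ℝ =>
      c ^ ν * (Real.exp (-(ν * s)) * Real.exp (-(x * Real.cosh s))) := by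
    simpa using hI.comp_neg
  -- Averaging over s ↦ -s replaces e^(νs) by cosh(νs). The integrand is then even and is written in
  -- |s| to be folded onto the half-line where `besselK` is defined.
  have h3 : 2 * extGamma ν (c ^ 2) = ∫ s : ℝ, (fun s : ℝ =>
      2 * c ^ ν * (Real.exp (-(x * Real.cosh s)) * Real.cosh (ν * s))) |s| := by
    rw [two_mul]
    nth_rewrite 1 [h1]
    rw [h2, ← integral_add hI hI2]
    congr 1; ext s
    beta_reduce
    have : Real.cosh (ν * |s|) = Real.cosh (ν * s) := by
      rcases abs_choice s with h | h <;> rw [h]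
      rw [mul_neg, Real.cosh_neg]
    rw [Real.cosh_abs, this, Real.cosh_eq (ν * s)]
    ring
  rw [integral_comp_abs (f := fun s : ℝ =>
    2 * c ^ ν * (Real.exp (-(x * Real.cosh s)) * Real.cosh (ν * s))), integral_const_mul] at h3
  rw [besselK]
  linarith

theorem matern_eq_extGamma {ν x : ℝ} (hν : 0 < ν) (hx : 0 < x) :
    matern ν x = extGamma ν ((x / 2) ^ 2) / Real.Gamma ν := by
  have hG := Real.Gamma_pos_of_pos hν
  rw [matern, extGamma_eq_besselK hν hx, Real.div_rpow hx.le zero_le_two,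
    Real.rpow_sub_one two_ne_zero]
  have : (0 : ℝ) < 2 ^ ν := by positivity
  field_simp

/-- By the recurrence and Γ(ν+1) = νΓ(ν), νM_(ν+1) is νM_ν plus the defect divided by Γ(ν), so the
Matérn terms cancel. -/
theorem matern_sub_matern_add_one {ν x : ℝ} (hν : 0 < ν) (hx : 0 < x) :
    1 + ν * matern ν x - ν * matern (ν + 1) x =
      1 - extGammaDefect ν ((x / 2) ^ 2) / Real.Gamma ν := by
  have hG := Real.Gamma_pos_of_pos hν
  rw [matern_eq_extGamma hν hx, matern_eq_extGamma (by linarith) hx,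
    extGamma_add_one hν (sq_nonneg _), Real.Gamma_add_one hν.ne']
  field_simp
  ring

end ExtendedGamma

/-! ### Spectral integrals by subordination to Gaussians -/

section SpectralIntegral

theorem integral_rpow_mul_exp_dirichletSymbol {L p : ℝ} (hp : 0 < p) (k : E3) :
    ∫ t in Set.Ioi (0 : ℝ), t ^ (p - 1) * Real.exp (-(dirichletSymbol L k * t)) =
      Real.Gamma p * dirichletSymbol L k ^ (-p) := by
  have h := dirichletSymbol_pos L k
  rw [Real.integral_rpow_mul_exp_neg_mul_Ioi hp h, one_div, Real.inv_rpow h.le,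
    Real.rpow_neg h.le, mul_comm]

/-- Γ(p)σ^(-p) is the integral of t^(p-1)e^(-σt); exchanging the integrals leaves a Gaussian
integral in k for each t. -/
theorem gamma_mul_integral_dirichletSymbol_rpow {L p : ℝ} (hp : 0 < p) {f : E3 → ℝ}
    (hf : Continuous f) (hfi : Integrable fun k : E3 => f k * dirichletSymbol L k ^ (-p)) :
    Real.Gamma p * ∫ k : E3, f k * dirichletSymbol L k ^ (-p) =
      ∫ t in Set.Ioi (0 : ℝ), Real.exp (-t) * t ^ (p - 1) *
        ∫ k : E3, f k * Real.exp (-(L ^ 2 * (2 * Real.pi) ^ 2 * t * ‖k‖ ^ 2)) := by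
  have hint : Integrable (Function.uncurry fun (k : E3) (t : ℝ) =>
      f k * (t ^ (p - 1) * Real.exp (-(dirichletSymbol L k * t))))
      (volume.prod (volume.restrict (Set.Ioi 0))) := by
    have hmeas : AEStronglyMeasurable (Function.uncurry fun (k : E3) (t : ℝ) =>
        f k * (t ^ (p - 1) * Real.exp (-(dirichletSymbol L k * t))))
        (volume.prod (volume.restrict (Set.Ioi 0))) := by
      have h1 : Measurable fun q : E3 × ℝ => f q.1 := (hf.comp continuous_fst).measurable
      have h2 : Measurable fun q : E3 × ℝ => dirichletSymbol L q.1 :=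
        ((continuous_dirichletSymbol L).comp continuous_fst).measurable
      exact (h1.mul ((measurable_snd.pow_const _).mul
        ((h2.mul measurable_snd).neg.exp))).aestronglyMeasurable
    rw [integrable_prod_iff hmeas]
    refine ⟨Eventually.of_forall fun k => ?_, ?_⟩
    · refine Integrable.const_mul (f := fun t : ℝ =>
        t ^ (p - 1) * Real.exp (-(dirichletSymbol L k * t))) ?_ (f k)
      -- The integral of a non-integrable function is 0 by convention, whereas its known value is
      -- positive.
      by_contra hcon
      have h0 := integral_undef hcon
      rw [integral_rpow_mul_exp_dirichletSymbol hp] at h0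
      have := Real.rpow_pos_of_pos (dirichletSymbol_pos L k) (-p)
      have := Real.Gamma_pos_of_pos hp
      exact absurd h0 (by positivity)
    · have : (fun k : E3 => ∫ t in Set.Ioi (0 : ℝ), ‖Function.uncurry (fun (k : E3) (t : ℝ) =>
          f k * (t ^ (p - 1) * Real.exp (-(dirichletSymbol L k * t)))) (k, t)‖) =
          fun k => Real.Gamma p * ‖f k * dirichletSymbol L k ^ (-p)‖ := by
        ext k
        rw [norm_mul, Real.norm_of_nonneg
          (Real.rpow_nonneg (dirichletSymbol_pos L k).le (-p)), mul_left_comm,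
          ← integral_rpow_mul_exp_dirichletSymbol hp, ← integral_const_mul]
        refine setIntegral_congr_fun measurableSet_Ioi fun t ht => ?_
        have : 0 ≤ t ^ (p - 1) * Real.exp (-(dirichletSymbol L k * t)) :=
          mul_nonneg (Real.rpow_nonneg (le_of_lt ht) _) (Real.exp_pos _).le
        simp only [Function.uncurry, norm_mul (f k), Real.norm_of_nonneg this]
      rw [this]
      exact hfi.norm.const_mul _
  have hswap := integral_integral_swap hint
  have hl : ∀ k : E3, ∫ t in Set.Ioi (0 : ℝ),
      f k * (t ^ (p - 1) * Real.exp (-(dirichletSymbol L k * t))) =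
      Real.Gamma p * (f k * dirichletSymbol L k ^ (-p)) := fun k => by
    rw [integral_const_mul, integral_rpow_mul_exp_dirichletSymbol hp]; ring
  simp only [hl, integral_const_mul] at hswap
  rw [hswap]
  refine setIntegral_congr_fun measurableSet_Ioi fun t _ => ?_
  rw [← integral_const_mul]
  congr 1; ext k
  have : Real.exp (-(dirichletSymbol L k * t)) =
      Real.exp (-t) * Real.exp (-(L ^ 2 * (2 * Real.pi) ^ 2 * t * ‖k‖ ^ 2)) := by
    rw [← Real.exp_add, dirichletSymbol]; congr 1; ring
  rw [this]; ring

theorem integrable_coord_sq_cos_dirichletSymbol {L : ℝ} (hL : 0 < L) (j : Fin 3) (a : ℝ) :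
    Integrable fun k : E3 =>
      k j ^ 2 * Real.cos (a * k 2) * dirichletSymbol L k ^ (-(17 / 6) : ℝ) := by
  have h := (integrable_coord_sq_mul_dirichletSymbol hL j).bdd_mul (c := 1)
    (f := fun k : E3 => Real.cos (a * k 2))
    (by fun_prop) (Eventually.of_forall fun k => by
      simpa using Real.abs_cos_le_one (a * k 2))
  refine h.congr (Eventually.of_forall fun k => ?_)
  simp only; ring

/-- The source of ν = 1/3: the three-dimensional Gaussian contributes t^(-3/2) and its second moment
t^(-1), so t^(17/6 - 1) becomes t^(1/3 - 1). -/
theorem sqrt_pow_three_mul_rpow {β t : ℝ} (hβ : 0 < β) (ht : 0 < t) :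
    √(Real.pi / (β * t)) ^ 3 * (1 / (2 * (β * t))) * t ^ (17 / 6 - 1 : ℝ) =
      √(Real.pi / β) ^ 3 / (2 * β) * t ^ (1 / 3 - 1 : ℝ) := by
  have h1 : √(Real.pi / (β * t)) = √(Real.pi / β) * t ^ (-(1 / 2) : ℝ) := by
    rw [← div_div, Real.sqrt_div (by positivity), Real.rpow_neg ht.le, ← Real.sqrt_eq_rpow,
      div_eq_mul_inv]
  have h2 : (t ^ (-(1 / 2) : ℝ)) ^ 3 * t ^ (-1 : ℝ) * t ^ (17 / 6 - 1 : ℝ) =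
      t ^ (1 / 3 - 1 : ℝ) := by
    rw [← Real.rpow_natCast, ← Real.rpow_mul ht.le, ← Real.rpow_add ht, ← Real.rpow_add ht]
    norm_num
  rw [h1, ← h2, Real.rpow_neg_one]
  field_simp

/-- The horizontal spectral moments are extended Gamma functions. -/
theorem integral_coord_sq_cos_dirichletSymbol {L : ℝ} (hL : 0 < L) {j : Fin 3} (hj : j ≠ 2)
    (z : ℝ) :
    Real.Gamma (17 / 6) * ∫ k : E3,
        k j ^ 2 * Real.cos (4 * Real.pi * z * k 2) * dirichletSymbol L k ^ (-(17 / 6) : ℝ) =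
      √(Real.pi / (L ^ 2 * (2 * Real.pi) ^ 2)) ^ 3 / (2 * (L ^ 2 * (2 * Real.pi) ^ 2)) *
        extGamma (1 / 3) ((z / L) ^ 2) := by
  rw [gamma_mul_integral_dirichletSymbol_rpow (by norm_num)
    (f := fun k : E3 => k j ^ 2 * Real.cos (4 * Real.pi * z * k 2)) (by fun_prop)
    (integrable_coord_sq_cos_dirichletSymbol hL j _), extGamma, ← integral_const_mul]
  refine setIntegral_congr_fun measurableSet_Ioi fun t ht => ?_
  have ht : 0 < t := ht
  have hβ : 0 < L ^ 2 * (2 * Real.pi) ^ 2 := by positivity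
  have h := integral_coord_sq_gaussian_cos (mul_pos hβ ht) (4 * Real.pi * z) hj
  simp only [mul_right_comm _ (Real.cos _), neg_mul] at h ⊢
  rw [h]
  -- The Gaussian exponent a²/(4b) with a = 4πz and b = L²(2π)²t.
  have hy : (4 * Real.pi * z) ^ 2 / (4 * (L ^ 2 * (2 * Real.pi) ^ 2 * t)) = (z / L) ^ 2 / t := by
    field_simp; ring
  rw [hy]
  have := sqrt_pow_three_mul_rpow hβ ht
  linear_combination Real.exp (-t) * Real.exp (-((z / L) ^ 2 / t)) * this

/-- The vertical spectral moment in terms of extended Gamma functions. -/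
theorem integral_coord_two_sq_cos_dirichletSymbol {L : ℝ} (hL : 0 < L) (z : ℝ) :
    Real.Gamma (17 / 6) * ∫ k : E3,
        k 2 ^ 2 * Real.cos (4 * Real.pi * z * k 2) * dirichletSymbol L k ^ (-(17 / 6) : ℝ) =
      √(Real.pi / (L ^ 2 * (2 * Real.pi) ^ 2)) ^ 3 / (2 * (L ^ 2 * (2 * Real.pi) ^ 2)) *
        (extGamma (1 / 3) ((z / L) ^ 2) - 2 * extGammaDefect (1 / 3) ((z / L) ^ 2)) := by
  rw [gamma_mul_integral_dirichletSymbol_rpow (by norm_num)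
    (f := fun k : E3 => k 2 ^ 2 * Real.cos (4 * Real.pi * z * k 2)) (by fun_prop)
    (integrable_coord_sq_cos_dirichletSymbol hL 2 _), extGamma, extGammaDefect,
    ← integral_const_mul 2, ← integral_sub (integrableOn_extGamma (by norm_num) (sq_nonneg _))
      ((integrableOn_extGammaDefect (by norm_num) (sq_nonneg _)).const_mul 2),
    ← integral_const_mul]
  refine setIntegral_congr_fun measurableSet_Ioi fun t ht => ?_
  have ht : 0 < t := ht
  have hβ : 0 < L ^ 2 * (2 * Real.pi) ^ 2 := by positivity
  have h := integral_coord_two_sq_gaussian_cos (mul_pos hβ ht) (4 * Real.pi * z)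
  simp only [mul_right_comm _ (Real.cos _), neg_mul] at h ⊢
  rw [h]
  have hy : (4 * Real.pi * z) ^ 2 / (4 * (L ^ 2 * (2 * Real.pi) ^ 2 * t)) = (z / L) ^ 2 / t := by
    field_simp; ring
  -- The correction in the vertical moment, relative to the horizontal one, is the factor 1 - 2y/t
  -- with y = (z/L)²; it produces the term -2D.
  have hy2 : 1 / (2 * (L ^ 2 * (2 * Real.pi) ^ 2 * t)) -
      (4 * Real.pi * z) ^ 2 / (4 * (L ^ 2 * (2 * Real.pi) ^ 2 * t) ^ 2) =
      1 / (2 * (L ^ 2 * (2 * Real.pi) ^ 2 * t)) * (1 - 2 * ((z / L) ^ 2 / t)) := by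
    field_simp; ring
  rw [hy, hy2]
  have := sqrt_pow_three_mul_rpow hβ ht
  linear_combination
    Real.exp (-t) * Real.exp (-((z / L) ^ 2 / t)) * (1 - 2 * ((z / L) ^ 2 / t)) * this

/-- The variance constant of the half-space von Kármán gradient kernels. -/
def gradVariance (L : ℝ) : ℝ :=
  (2 * Real.pi) ^ 2 * (√(Real.pi / (L ^ 2 * (2 * Real.pi) ^ 2)) ^ 3 /
    (L ^ 2 * (2 * Real.pi) ^ 2 * Real.Gamma (17 / 6)))

theorem gradVariance_pos {L : ℝ} (hL : 0 < L) : 0 < gradVariance L := by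
  have := Real.Gamma_pos_of_pos (s := 17 / 6) (by norm_num)
  rw [gradVariance]
  positivity

/-- The image terms of the horizontal and vertical parts have opposite signs, so the extended Gamma
integrals cancel and only the defect of the vertical moment remains. -/
theorem norm_gradKernelR_sq_add {L : ℝ} (hL : 0 < L) {j : Fin 3} (hj : j ≠ 2) (x : E3) :
    ‖gradKernelR hL j x‖ ^ 2 + ‖gradKernelR hL 2 x‖ ^ 2 =
      gradVariance L *
        (Real.Gamma (1 / 3) - extGammaDefect (1 / 3) ((x 2 / L) ^ 2)) := by
  have hG := Real.Gamma_pos_of_pos (s := 17 / 6) (by norm_num)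
  -- The constant term is written as a cosine with z = 0, so that the same two moment formulas
  -- evaluate it.
  have split : ∀ (i : Fin 3) (c : ℝ), ∫ k : E3, k i ^ 2 * dirichletSymbol L k ^ (-(17 / 6) : ℝ) *
      (1 + c * Real.cos (4 * Real.pi * x 2 * k 2)) =
      (∫ k : E3, k i ^ 2 * Real.cos (4 * Real.pi * 0 * k 2) *
        dirichletSymbol L k ^ (-(17 / 6) : ℝ)) +
      c * ∫ k : E3, k i ^ 2 * Real.cos (4 * Real.pi * x 2 * k 2) *
        dirichletSymbol L k ^ (-(17 / 6) : ℝ) := fun i c => by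
    rw [← integral_const_mul, ← integral_add (integrable_coord_sq_cos_dirichletSymbol hL i _)
      ((integrable_coord_sq_cos_dirichletSymbol hL i _).const_mul c)]
    congr 1; ext k
    rw [mul_zero, zero_mul, Real.cos_zero]
    ring
  rw [norm_gradKernelR_sq, norm_gradKernelR_sq, split, split, if_neg hj, if_pos rfl]
  have h1 := integral_coord_sq_cos_dirichletSymbol hL hj 0
  have h2 := integral_coord_sq_cos_dirichletSymbol hL hj (x 2)
  have h3 := integral_coord_two_sq_cos_dirichletSymbol hL 0
  have h4 := integral_coord_two_sq_cos_dirichletSymbol hL (x 2)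
  rw [zero_div, zero_pow two_ne_zero, extGamma_zero (by norm_num)] at h1 h3
  rw [extGammaDefect_zero] at h3
  have hβ : 0 < L ^ 2 * (2 * Real.pi) ^ 2 := by positivity
  rw [mul_comm, ← eq_div_iff hG.ne'] at h1 h2 h3 h4
  rw [h1, h2, h3, h4, gradVariance]
  field_simp
  ring

end SpectralIntegral

/-! ### Reynolds stresses and their limits -/

section ReynoldsStress

variable {Ω : Type*} [MeasurableSpace Ω] {P : Measure Ω}

/-- The limit of the tangential Reynolds stresses far from the wall. -/
def farStress (L μ : ℝ) : ℝ :=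
  (μ * L ^ (17 / 6 : ℝ)) ^ 2 * (gradVariance L * Real.Gamma (1 / 3))

theorem farStress_pos {L μ : ℝ} (hL : 0 < L) (hμ : 0 < μ) : 0 < farStress L μ := by
  have := Real.Gamma_pos_of_pos (s := 1 / 3) (by norm_num)
  have := gradVariance_pos hL
  rw [farStress]
  positivity

theorem IsVelocity.reynoldsStress_div {L μ : ℝ} (hL : 0 < L) (hμ : 0 < μ)
    {ξ : Fin 3 → L2R → Lp ℝ 2 P} (hξ : IsWhiteNoise P ξ)
    {ψ : Fin 3 → RandomDistribution P} (hψ : IsVonKarmanSolution P L μ ξ ψ)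
    {u : Fin 3 → E3 → Lp ℝ 2 P} (hu : IsVelocity ψ u) {i : Fin 3} (hi : i = 0 ∨ i = 1)
    {x : E3} (hx : x ∈ halfSpace) :
    reynoldsStress u i i x / farStress L μ =
      1 - extGammaDefect (1 / 3) ((x 2 / L) ^ 2) / Real.Gamma (1 / 3) := by
  have hG := Real.Gamma_pos_of_pos (s := 1 / 3) (by norm_num)
  have hV := gradVariance_pos hL
  have hc : 0 < μ * L ^ (17 / 6 : ℝ) := by positivity
  have key : reynoldsStress u i i x = (μ * L ^ (17 / 6 : ℝ)) ^ 2 *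
      (gradVariance L * (Real.Gamma (1 / 3) - extGammaDefect (1 / 3) ((x 2 / L) ^ 2))) := by
    rcases hi with rfl | rfl
    · rw [hu.reynoldsStress_zero hL hξ hψ hx, norm_gradKernelR_sq_add hL (by decide)]
    · rw [hu.reynoldsStress_one hL hξ hψ hx, norm_gradKernelR_sq_add hL (by decide)]
  rw [key, farStress]
  field_simp

theorem tendsto_div_sq_atTop {L : ℝ} (hL : 0 < L) :
    Tendsto (fun x : E3 => (x 2 / L) ^ 2) (comap (fun x : E3 => x 2) atTop) atTop :=
  ((tendsto_pow_atTop two_ne_zero).comp (tendsto_id.atTop_div_const hL)).comp tendsto_comap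

theorem tendsto_div_sq_nhdsGT (L : ℝ) :
    Tendsto (fun x : E3 => (x 2 / L) ^ 2) (comap (fun x : E3 => x 2 / L) (𝓝[>] 0)) (𝓝[>] 0) := by
  refine Tendsto.comp (g := fun r : ℝ => r ^ 2) (y := 𝓝[>] 0) ?_ tendsto_comap
  refine tendsto_nhdsWithin_iff.2 ⟨?_, ?_⟩
  · have : Tendsto (fun r : ℝ => r ^ 2) (𝓝 0) (𝓝 (0 ^ 2)) := (continuous_pow 2).tendsto 0
    rw [zero_pow two_ne_zero] at this
    exact this.mono_left nhdsWithin_le_nhds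
  · filter_upwards [self_mem_nhdsWithin] with r hr
    exact pow_pos (Set.mem_Ioi.1 hr) 2

variable {L μ : ℝ} {ξ : Fin 3 → L2R → Lp ℝ 2 P} {ψ : Fin 3 → RandomDistribution P}
  {u : Fin 3 → E3 → Lp ℝ 2 P} {i : Fin 3}

/-- The far field and the wall are treated together: in both regimes the normalized stress tends to
1 because the defect tends to 0. -/
theorem IsVelocity.tendsto_reynoldsStress_div (hL : 0 < L) (hμ : 0 < μ)
    (hξ : IsWhiteNoise P ξ) (hψ : IsVonKarmanSolution P L μ ξ ψ) (hu : IsVelocity ψ u)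
    (hi : i = 0 ∨ i = 1) {l : Filter E3} (hl : ∀ᶠ x in l, x ∈ halfSpace)
    (h : Tendsto (fun x : E3 => extGammaDefect (1 / 3) ((x 2 / L) ^ 2)) l (𝓝 0)) :
    Tendsto (fun x => reynoldsStress u i i x / farStress L μ) l (𝓝 1) := by
  have h' := (h.div_const (Real.Gamma (1 / 3))).const_sub 1
  rw [zero_div, sub_zero] at h'
  refine h'.congr' ?_
  filter_upwards [hl] with x hx
  rw [hu.reynoldsStress_div hL hμ hξ hψ hi hx]

theorem IsVelocity.tendsto_reynoldsStress_atTop (hL : 0 < L) (hμ : 0 < μ)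
    (hξ : IsWhiteNoise P ξ) (hψ : IsVonKarmanSolution P L μ ξ ψ) (hu : IsVelocity ψ u)
    (hi : i = 0 ∨ i = 1) :
    Tendsto (reynoldsStress u i i) (comap (fun x : E3 => x 2) atTop) (𝓝 (farStress L μ)) := by
  have h := (hu.tendsto_reynoldsStress_div hL hμ hξ hψ hi
    ((tendsto_comap.eventually (eventually_gt_atTop 0)).mono fun x hx => mem_halfSpace.2 hx)
    ((tendsto_extGammaDefect_atTop (by norm_num)).comp (tendsto_div_sq_atTop hL))).mul_const
      (farStress L μ)
  rw [one_mul] at h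
  exact h.congr fun x => div_mul_cancel₀ _ (farStress_pos hL hμ).ne'

theorem IsVelocity.tendsto_reynoldsStress_wall (hL : 0 < L) (hμ : 0 < μ)
    (hξ : IsWhiteNoise P ξ) (hψ : IsVonKarmanSolution P L μ ξ ψ) (hu : IsVelocity ψ u)
    (hi : i = 0 ∨ i = 1) :
    Tendsto (fun x => reynoldsStress u i i x / farStress L μ)
      (comap (fun x : E3 => x 2 / L) (𝓝[>] 0)) (𝓝 1) := by
  refine hu.tendsto_reynoldsStress_div hL hμ hξ hψ hi ?_
    ((tendsto_extGammaDefect_zero (by norm_num)).comp (tendsto_div_sq_nhdsGT L))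
  filter_upwards [tendsto_comap.eventually self_mem_nhdsWithin] with x hx
  exact mem_halfSpace.2 ((div_pos_iff_of_pos_right hL).1 hx)

theorem IsVelocity.reynoldsStress_div_eq_matern (hL : 0 < L) (hμ : 0 < μ)
    (hξ : IsWhiteNoise P ξ) (hψ : IsVonKarmanSolution P L μ ξ ψ) (hu : IsVelocity ψ u)
    (hi : i = 0 ∨ i = 1) {x : E3} (hx : x ∈ halfSpace) :
    reynoldsStress u i i x / farStress L μ =
      1 + 1 / 3 * matern (1 / 3) (2 * x 2 / L) - 1 / 3 * matern (1 / 3 + 1) (2 * x 2 / L) := by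
  have hx2 : 0 < x 2 := mem_halfSpace.1 hx
  rw [hu.reynoldsStress_div hL hμ hξ hψ hi hx,
    matern_sub_matern_add_one (by norm_num) (by positivity),
    show 2 * x 2 / L / 2 = x 2 / L by ring]

end ReynoldsStress

end

theorem mainTheorem3 {Ω : Type*} [MeasurableSpace Ω] (P : Measure Ω) [IsProbabilityMeasure P]
    (L μ : ℝ) (hL : 0 < L) (hμ : 0 < μ)
    (ξ : Fin 3 → L2R → Lp ℝ 2 P) (hξ : IsWhiteNoise P ξ)
    (ψ : Fin 3 → RandomDistribution P) (hψ : IsVonKarmanSolution P L μ ξ ψ) :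
    (∃ u : Fin 3 → E3 → Lp ℝ 2 P, IsVelocity ψ u) ∧
    ∀ u : Fin 3 → E3 → Lp ℝ 2 P, IsVelocity ψ u →
      ∃ s : ℝ, 0 < s ∧
        Tendsto (reynoldsStress u 0 0) (comap (fun x : E3 => x 2) atTop) (𝓝 s) ∧
        Tendsto (reynoldsStress u 1 1) (comap (fun x : E3 => x 2) atTop) (𝓝 s) ∧
        (∀ x ∈ halfSpace,
          reynoldsStress u 0 0 x / s =
            1 + 1 / 3 * matern (1 / 3) (2 * x 2 / L) - 1 / 3 * matern (1 / 3 + 1) (2 * x 2 / L) ∧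
          reynoldsStress u 1 1 x / s =
            1 + 1 / 3 * matern (1 / 3) (2 * x 2 / L) - 1 / 3 * matern (1 / 3 + 1) (2 * x 2 / L)) ∧
        Tendsto (fun x => reynoldsStress u 0 0 x / s)
          (comap (fun x : E3 => x 2 / L) (𝓝[>] 0)) (𝓝 1) ∧
        Tendsto (fun x => reynoldsStress u 1 1 x / s)
          (comap (fun x : E3 => x 2 / L) (𝓝[>] 0)) (𝓝 1) := by
  refine ⟨⟨_, isVelocity_velocityField hL hξ hψ⟩, fun u hu => ⟨farStress L μ, farStress_pos hL hμ,
    hu.tendsto_reynoldsStress_atTop hL hμ hξ hψ (.inl rfl),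
    hu.tendsto_reynoldsStress_atTop hL hμ hξ hψ (.inr rfl),
    fun x hx => ⟨hu.reynoldsStress_div_eq_matern hL hμ hξ hψ (.inl rfl) hx,
      hu.reynoldsStress_div_eq_matern hL hμ hξ hψ (.inr rfl) hx⟩,
    hu.tendsto_reynoldsStress_wall hL hμ hξ hψ (.inl rfl),
    hu.tendsto_reynoldsStress_wall hL hμ hξ hψ (.inr rfl)⟩⟩
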